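/- Let $\Theta\subseteq\mathbb{R}^n$ be closed and convex with $\ell_2$-diameter at most $D>0$, and let $c^*\in\Theta$. For a non-empty compact set $X\subseteq\mathbb{R}^n$ and $x\in X$, put $\ell_{X,x}(c)=\max_{x'\in X}\langle c,x'\rangle-\langle c,x\rangle$. Let $K,B>0$, $\Delta\ge 0$, and let $\mu$ be a probability distribution on pairs $(X,x)$ as above such that, $\mu$-almost surely, $X$ has $\ell_2$-diameter at most $K$, $\langle c-c',y-y'\rangle\le B$ for all $c,c'\in\Theta$ and $y,y'\in X$, and $\ell_{X,x}(c^*)\le\Delta$. Let $(X_1,x_1),\dots,(X_T,x_T)$ be drawn i.i.d. from $\mu$. Let $\hat c_1,\dots,\hat c_T$ be the outputs of MetaGrad on $\Theta$ (horizon $T$, parameters $W=D$, $H=B$) applied to the losses $\ell_t=\ell_{X_t,x_t}$ with subgradients $g_t=\hat x_t-x_t\in\partial\ell_t(\hat c_t)$, where $\hat x_t\in\operatorname{argmax}_{x\in X_t}\langle\hat c_t,x\rangle$ is chosen (with ties broken arbitrarily) as a measurable function of $(X_1,x_1),\dots,(X_t,x_t)$. That is, let $m=\lceil\frac12\log_2T\rceil$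 and $\eta_i=\frac{2^{-i}}{5B}$ for $i=0,\dots,m$, and let $p_1^{i}=\frac{1}{(i+1)(i+2)}\left(1+\frac1{1+m}\right)$, $\gamma_i=\frac12\min\left\{\frac1{\eta_iB+2\eta_i^2B^2},\frac{2}{(1+2\eta_iB)^2}\right\}$, $A_0^i=\frac{n}{D^2\gamma_i^2}I_n$, and let $w_1^i\in\Theta$ be arbitrary fixed points. In round $t=1,\dots,T$ play $$\hat c_t=\frac{\sum_i\eta_ip_t^iw_t^i}{\sum_i\eta_ip_t^i},$$ put $f_t^i(w)=-\eta_i\langle\hat c_t-w,g_t\rangle+\eta_i^2\langle\hat c_t-w,g_t\rangle^2$, and update $$p_{t+1}^i=\frac{p_t^ie^{-f_t^i(w_t^i)}}{\sum_jp_t^je^{-f_t^j(w_t^j)}},\qquad A_t^i=A_{t-1}^i+\nabla f_t^i(w_t^i)\nabla f_t^i(w_t^i)^\top,$$ $$w_{t+1}^i=\operatorname*{argmin}_{w\in\Theta}\ (y_t^i-w)^\top A_t^i(y_t^i-w),\qquad y_t^i=w_t^i-\tfrac1{\gamma_i}(A_t^i)^{-1}\nabla f_t^i(w_t^i).$$ Then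 for every $\rho_0>1$ there is a constant $C>0$ depending only on $\rho_0$ such that, for all $n,T,D,K,B,\Delta,\Theta,c^*,\mu$ as above with $\frac{DKT}{Bn}\ge\rho_0$, the excess loss below is integrable and $$\mathbb{E}\left[\ell_{X,x}\left(\frac1T\sum_{t=1}^T\hat c_t\right)-\ell_{X,x}(c^*)\right]\le C\left(\frac{Bn}{T}\ln\frac{DKT}{Bn}+\sqrt{\frac{\Delta Bn}{T}\ln\frac{DKT}{Bn}}\right),$$ where $(X,x)\sim\mu$ is independent of the sample and the expectation is over both. -/

import Mathlib

open MeasureTheory ProbabilityTheory TopologicalSpace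
open scoped RealInnerProductSpace Matrix

noncomputable section

namespace InverseOpt

/-- `ℝⁿ` with the Euclidean norm. -/
abbrev E (n : ℕ) : Type := EuclideanSpace ℝ (Fin n)

/-! ### Observations and the suboptimality loss -/

/-- An observation `(X, x)`: a non-empty compact feasible set together with an action in it. -/
structure Observation (n : ℕ) where
  X : NonemptyCompacts (E n)
  x : E n
  mem : x ∈ X

/-- The σ-algebra on observations is the trace of the Borel σ-algebra of
`NonemptyCompacts ℝⁿ × ℝⁿ`, with the Hausdorff metric on the first factor. -/
instance (n : ℕ) : MeasurableSpace (Observation n) :=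
  MeasurableSpace.comap (fun o : Observation n => (o.X, o.x))
    (borel (NonemptyCompacts (E n) × E n))

/-- `ℓ_{X,x}(c) = max_{x' ∈ X} ⟪c, x'⟫ - ⟪c, x⟫`. -/
def suboptLoss {n : ℕ} (o : Observation n) (c : E n) : ℝ :=
  sSup ((fun x' : E n => ⟪c, x'⟫) '' (o.X : Set (E n))) - ⟪c, o.x⟫

/-- `argmax_{x ∈ X} ⟪c, x⟫`. -/
def linArgmax {n : ℕ} (X : Set (E n)) (c : E n) : Set (E n) :=
  {x | x ∈ X ∧ ∀ x' ∈ X, ⟪c, x'⟫ ≤ ⟪c, x⟫}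

/-! ### Online Newton step -/

/-- `‖v‖_A² = vᵀ A v`. -/
def sqNormWrt {n : ℕ} (A : Matrix (Fin n) (Fin n) ℝ) (v : E n) : ℝ :=
  v.ofLp ⬝ᵥ (A *ᵥ v.ofLp)

/-- Generalized projection: a point of `argmin {‖y - w‖_A² | w ∈ 𝒲}`. The minimizer exists and is
unique for non-empty closed convex `𝒲` and positive definite `A`. -/
def genProj {n : ℕ} (𝒲 : Set (E n)) (A : Matrix (Fin n) (Fin n) ℝ) (y : E n) : E n :=
  Classical.epsilon fun w => w ∈ 𝒲 ∧ ∀ w' ∈ 𝒲, sqNormWrt A (y - w) ≤ sqNormWrt A (y - w')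

/-- The state of ONS at the start of a round `t`: the point `w_t` and the matrix `A_{t-1}`. -/
structure ONSState (n : ℕ) where
  point : E n
  mat : Matrix (Fin n) (Fin n) ℝ

/-- `γ = ½ min {1/β, α}`. -/
def onsGamma (α β : ℝ) : ℝ := 1 / 2 * min (1 / β) α

/-- Initial state: `w₁` and `A₀ = ε Iₙ` with `ε = n / (W² γ²)`. -/
def onsInit {n : ℕ} (W γ : ℝ) (w₁ : E n) : ONSState n where
  point := w₁
  mat := ((n : ℝ) / (W ^ 2 * γ ^ 2)) • (1 : Matrix (Fin n) (Fin n) ℝ)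

/-- One ONS update on the loss `q`: `A_t = A_{t-1} + ∇q(w_t) ∇q(w_t)ᵀ`, and `w_{t+1}` is the
generalized projection of `w_t - γ⁻¹ A_t⁻¹ ∇q(w_t)`. -/
def onsStep {n : ℕ} (𝒲 : Set (E n)) (γ : ℝ) (q : E n → ℝ) (s : ONSState n) : ONSState n :=
  let d : E n := gradient q s.point
  let A : Matrix (Fin n) (Fin n) ℝ := s.mat + Matrix.vecMulVec d.ofLp d.ofLp
  { point := genProj 𝒲 A (s.point - (1 / γ) • WithLp.toLp 2 (A⁻¹ *ᵥ d.ofLp))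
    mat := A }

/-! ### MetaGrad -/

/-- `f^η(v) = -η ⟪w - v, g⟫ + η² ⟪w - v, g⟫²`. -/
def surrogate {n : ℕ} (η : ℝ) (w g v : E n) : ℝ :=
  -η * ⟪w - v, g⟫ + η ^ 2 * ⟪w - v, g⟫ ^ 2

/-- `⌈½ log₂ T⌉`, the largest index of a grid point. -/
def gridMax (T : ℕ) : ℕ := ⌈1 / 2 * Real.logb 2 (T : ℝ)⌉₊

/-- Grid point `η_i = 2^{-i} / (5H)`. -/
def gridPoint (H : ℝ) (i : ℕ) : ℝ := ((2 : ℝ) ^ i)⁻¹ / (5 * H)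

/-- The parameter `γ` of the ONS run by the `η`-expert, for the exp-concavity parameter
`α = 2 / (1 + 2ηH)²` and the bound `β = ηH + 2η²H²`. -/
def expertGamma (H η : ℝ) : ℝ :=
  onsGamma (2 / (1 + 2 * η * H) ^ 2) (η * H + 2 * η ^ 2 * H ^ 2)

/-- The state of MetaGrad at the start of a round: the states of the experts and their weights. -/
structure MetaGradState (n T : ℕ) where
  expert : Fin (gridMax T + 1) → ONSState n
  weight : Fin (gridMax T + 1) → ℝ

/-- Initial state, with prior `C / ((i+1)(i+2))`, `C = 1 + 1 / (1 + ⌈½ log₂ T⌉)`, and with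
starting points `w₁ i` of the experts. -/
def metaGradInit {n T : ℕ} (W H : ℝ) (w₁ : Fin (gridMax T + 1) → E n) : MetaGradState n T where
  expert i := onsInit W (expertGamma H (gridPoint H i)) (w₁ i)
  weight i := (1 + 1 / (1 + (gridMax T : ℝ))) / (((i : ℕ) + 1 : ℝ) * ((i : ℕ) + 2 : ℝ))

/-- The point played, `w_t = (∑ η p^η_t w^η_t) / (∑ η p^η_t)`. -/
def MetaGradState.play {n T : ℕ} (H : ℝ) (s : MetaGradState n T) : E n :=
  (∑ i : Fin (gridMax T + 1), gridPoint H i * s.weight i)⁻¹ •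
    ∑ i : Fin (gridMax T + 1), (gridPoint H i * s.weight i) • (s.expert i).point

/-- The update after observing the subgradient `g` at the point played. -/
def MetaGradState.step {n T : ℕ} (𝒲 : Set (E n)) (H : ℝ) (s : MetaGradState n T) (g : E n) :
    MetaGradState n T :=
  let f : Fin (gridMax T + 1) → E n → ℝ := fun i => surrogate (gridPoint H i) (s.play H) g
  { expert := fun i => onsStep 𝒲 (expertGamma H (gridPoint H i)) (f i) (s.expert i)
    weight := fun i => s.weight i * Real.exp (-(f i (s.expert i).point)) /
      ∑ j, s.weight j * Real.exp (-(f j (s.expert j).point)) }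

/-- The state of MetaGrad after being fed the subgradients `g 0, …, g (t-1)`. -/
def metaGradState {n T : ℕ} (𝒲 : Set (E n)) (W H : ℝ) (w₁ : Fin (gridMax T + 1) → E n)
    (g : ℕ → E n) : ℕ → MetaGradState n T
  | 0 => metaGradInit W H w₁
  | t + 1 => (metaGradState 𝒲 W H w₁ g t).step 𝒲 H (g t)

/-- The output of MetaGrad (with horizon `T`, on the domain `𝒲` with parameters `W`, `H`) in round
`t`, the rounds being numbered from `0`; it depends only on `g 0, …, g (t-1)`. -/
def metaGrad {n T : ℕ} (𝒲 : Set (E n)) (W H : ℝ) (w₁ : Fin (gridMax T + 1) → E n)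
    (g : ℕ → E n) (t : ℕ) : E n :=
  (metaGradState 𝒲 W H w₁ g t).play H

end InverseOpt

end

namespace InverseOpt

/-! Write r_t = ⟪ĉ_t - c*, g_t⟫, R = ∑ r_t, V = ∑ r_t² and ρ = DKT/(Bn). The loss is convex, and ĉ_t
depends only on the rounds before t, so it is independent of (X_t, x_t). Hence the expected excess
loss of the average is at most 1/T times the expected sum of ℓ_t(ĉ_t) - ℓ_t(c*), which is at most R
(`integral_prod_eq_of_indepFun`, `suboptLoss_average_le`). It remains to bound R on almost every
sample path.

For each grid rate η, a single potential handles both layers of MetaGrad. It adds up the negated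
surrogates at u, the ONS distance γ/2 ‖w - u‖²_A, the term -(log det A)/(2γ) and -log p, and it
never increases (`metaGrad_potential_le`). The surrogates at the expert's own point cancel between
the ONS bound (`onsStep_potential_le`) and the weight bound (`log_weight_le_log_weight_succ`).
Bounding the determinant through the trace gives ηR - η²V ≤ n log(1 + ρ²) + n + 2 log(i + 2)
(`metaGrad_regret_le`).

The rate in Δ comes from self-bounding: losses are nonnegative and ℓ_t(c*) ≤ Δ, so r_t ≥ -Δ, whence
r_t² ≤ H(r_t + 2Δ) whenever |r_t| ≤ H. Thus V is controlled by R itself plus TΔ, and tuning η over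
the grid solves the resulting inequality for R (`sum_le_of_grid_bound`). -/

variable {n T : ℕ}

/-! ### Matrices as operators and quadratic forms on Euclidean space -/

/-- The action of a matrix on `ℝⁿ`. -/
def act (A : Matrix (Fin n) (Fin n) ℝ) (v : E n) : E n := WithLp.toLp 2 (A *ᵥ v.ofLp)

lemma inner_eq_dotProduct (v w : E n) : ⟪v, w⟫ = v.ofLp ⬝ᵥ w.ofLp := by
  rw [EuclideanSpace.inner_eq_star_dotProduct, star_trivial, dotProduct_comm]

lemma sqNormWrt_eq_inner (A : Matrix (Fin n) (Fin n) ℝ) (v : E n) :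
    sqNormWrt A v = ⟪v, act A v⟫ := by
  rw [inner_eq_dotProduct]; rfl

lemma act_add (A : Matrix (Fin n) (Fin n) ℝ) (v w : E n) : act A (v + w) = act A v + act A w := by
  simp [act, Matrix.mulVec_add]

lemma act_sub (A : Matrix (Fin n) (Fin n) ℝ) (v w : E n) : act A (v - w) = act A v - act A w := by
  simp [act, Matrix.mulVec_sub]

lemma act_smul (A : Matrix (Fin n) (Fin n) ℝ) (c : ℝ) (v : E n) : act A (c • v) = c • act A v := by
  simp [act, Matrix.mulVec_smul]

lemma inner_act_comm {A : Matrix (Fin n) (Fin n) ℝ} (hA : A.IsSymm) (v w : E n) :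
    ⟪v, act A w⟫ = ⟪w, act A v⟫ := by
  rw [inner_eq_dotProduct, inner_eq_dotProduct]
  simp only [act]
  rw [Matrix.dotProduct_mulVec, ← Matrix.mulVec_transpose, hA.eq, dotProduct_comm]

lemma sqNormWrt_add {A : Matrix (Fin n) (Fin n) ℝ} (hA : A.IsSymm) (v w : E n) :
    sqNormWrt A (v + w) = sqNormWrt A v + 2 * ⟪w, act A v⟫ + sqNormWrt A w := by
  simp only [sqNormWrt_eq_inner, act_add, inner_add_left, inner_add_right]
  rw [inner_act_comm hA v w]; ring

lemma sqNormWrt_smul (A : Matrix (Fin n) (Fin n) ℝ) (c : ℝ) (v : E n) :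
    sqNormWrt A (c • v) = c ^ 2 * sqNormWrt A v := by
  simp only [sqNormWrt_eq_inner, act_smul, inner_smul_left, inner_smul_right]
  simp; ring

lemma sqNormWrt_smul_one (ε : ℝ) (v : E n) :
    sqNormWrt (ε • (1 : Matrix (Fin n) (Fin n) ℝ)) v = ε * ‖v‖ ^ 2 := by
  have : act (ε • (1 : Matrix (Fin n) (Fin n) ℝ)) v = ε • v := by
    simp [act, Matrix.smul_mulVec]
  rw [sqNormWrt_eq_inner, this, inner_smul_right, real_inner_self_eq_norm_sq]

lemma sqNormWrt_add_vecMulVec (A : Matrix (Fin n) (Fin n) ℝ) (d v : E n) :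
    sqNormWrt (A + Matrix.vecMulVec d.ofLp d.ofLp) v = sqNormWrt A v + ⟪d, v⟫ ^ 2 := by
  simp only [sqNormWrt, Matrix.add_mulVec, dotProduct_add, inner_eq_dotProduct]
  rw [Matrix.vecMulVec_mulVec]
  simp [dotProduct_smul, dotProduct_comm]
  ring

lemma continuous_act : Continuous fun p : Matrix (Fin n) (Fin n) ℝ × E n => act p.1 p.2 := by
  unfold act
  fun_prop

lemma continuous_sqNormWrt (A : Matrix (Fin n) (Fin n) ℝ) : Continuous (sqNormWrt A) := by
  unfold sqNormWrt
  fun_prop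

/-- Symmetric matrices bounded below by `ε I`. -/
structure IsCoercive (ε : ℝ) (A : Matrix (Fin n) (Fin n) ℝ) : Prop where
  symm : A.IsSymm
  le : ∀ v : E n, ε * ‖v‖ ^ 2 ≤ sqNormWrt A v

lemma IsCoercive.smul_one (ε : ℝ) : IsCoercive ε (ε • (1 : Matrix (Fin n) (Fin n) ℝ)) :=
  ⟨by simp [Matrix.IsSymm], fun v => (sqNormWrt_smul_one ε v).ge⟩

lemma IsCoercive.add_vecMulVec {ε : ℝ} {A : Matrix (Fin n) (Fin n) ℝ} (hA : IsCoercive ε A)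
    (d : E n) : IsCoercive ε (A + Matrix.vecMulVec d.ofLp d.ofLp) := by
  refine ⟨?_, fun v => ?_⟩
  · rw [Matrix.IsSymm, Matrix.transpose_add, hA.symm.eq, Matrix.transpose_vecMulVec]
  · rw [sqNormWrt_add_vecMulVec]
    nlinarith [hA.le v, sq_nonneg ⟪d, v⟫]

lemma IsCoercive.nonneg {ε : ℝ} (hε : 0 ≤ ε) {A : Matrix (Fin n) (Fin n) ℝ}
    (hA : IsCoercive ε A) (v : E n) : 0 ≤ sqNormWrt A v :=
  le_trans (by positivity) (hA.le v)

lemma IsCoercive.posDef {ε : ℝ} (hε : 0 < ε) {A : Matrix (Fin n) (Fin n) ℝ}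
    (hA : IsCoercive ε A) : A.PosDef := by
  refine Matrix.PosDef.of_dotProduct_mulVec_pos ?_ fun x hx => ?_
  · rw [Matrix.IsHermitian, Matrix.conjTranspose_eq_transpose_of_trivial, hA.symm.eq]
  · have h := hA.le (WithLp.toLp 2 x)
    have hx' : 0 < ‖WithLp.toLp 2 x‖ := by simpa using hx
    rw [star_trivial]
    exact lt_of_lt_of_le (by positivity) h

/-! ### The generalized projection -/

lemma genProj_spec {Θ : Set (E n)} (hΘ : IsCompact Θ) (hne : Θ.Nonempty)
    (A : Matrix (Fin n) (Fin n) ℝ) (y : E n) :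
    genProj Θ A y ∈ Θ ∧ ∀ w' ∈ Θ, sqNormWrt A (y - genProj Θ A y) ≤ sqNormWrt A (y - w') := by
  have hc : ContinuousOn (fun w => sqNormWrt A (y - w)) Θ :=
    ((continuous_sqNormWrt A).comp (continuous_const.sub continuous_id)).continuousOn
  obtain ⟨w, hw, hmin⟩ := hΘ.exists_isMinOn hne hc
  exact Classical.epsilon_spec
    (p := fun w => w ∈ Θ ∧ ∀ w' ∈ Θ, sqNormWrt A (y - w) ≤ sqNormWrt A (y - w'))
    ⟨w, hw, fun w' hw' => hmin hw'⟩

/-- First-order optimality of the projection, from comparing it with nearby points of the segment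
towards `w`. Positivity of `A` is not needed. -/
lemma inner_act_sub_genProj_nonpos {Θ : Set (E n)} (hΘ : IsCompact Θ) (hconv : Convex ℝ Θ)
    {A : Matrix (Fin n) (Fin n) ℝ} (hA : A.IsSymm) (y : E n) {w : E n} (hw : w ∈ Θ) :
    ⟪w - genProj Θ A y, act A (y - genProj Θ A y)⟫ ≤ 0 := by
  obtain ⟨hp, hmin⟩ := genProj_spec hΘ ⟨w, hw⟩ A y
  set p := genProj Θ A y
  by_contra! hpos
  set a := ⟪w - p, act A (y - p)⟫
  set b := sqNormWrt A (w - p)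
  have key : ∀ s : ℝ, 0 < s → s ≤ 1 → 2 * a ≤ s * b := by
    intro s hs hs1
    have hmem : p + s • (w - p) ∈ Θ := hconv.add_smul_sub_mem hp hw ⟨hs.le, hs1⟩
    have h := hmin _ hmem
    have e : y - (p + s • (w - p)) = (y - p) + (-s) • (w - p) := by
      rw [neg_smul]; abel
    rw [e, sqNormWrt_add hA, sqNormWrt_smul, inner_smul_left] at h
    simp only [conj_trivial] at h
    have : 0 ≤ s * (s * b - 2 * a) := by
      have : s * (s * b - 2 * a) = 2 * (-s * a) + (-s) ^ 2 * b := by ring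
      rw [this]; linarith
    have := nonneg_of_mul_nonneg_right this hs
    linarith
  -- If `a > 0`, then `s = 1` forces `b ≥ 2a > 0`, so `s = a / b` is admissible and gives `2a ≤ a`.
  have h1 := key 1 one_pos le_rfl
  have hb : 0 < b := by linarith
  have h2 := key (a / b) (by positivity) (by rw [div_le_one hb]; linarith)
  rw [div_mul_cancel₀ _ hb.ne'] at h2
  linarith

lemma sqNormWrt_genProj_sub_le {Θ : Set (E n)} (hΘ : IsCompact Θ) (hconv : Convex ℝ Θ)
    {ε : ℝ} (hε : 0 ≤ ε) {A : Matrix (Fin n) (Fin n) ℝ} (hA : IsCoercive ε A) (y : E n)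
    {u : E n} (hu : u ∈ Θ) :
    sqNormWrt A (genProj Θ A y - u) ≤ sqNormWrt A (y - u) := by
  have h := inner_act_sub_genProj_nonpos hΘ hconv hA.symm y hu
  set p := genProj Θ A y
  have e : y - u = (y - p) + (p - u) := by abel
  rw [e, sqNormWrt_add hA.symm]
  have : ⟪p - u, act A (y - p)⟫ = - ⟪u - p, act A (y - p)⟫ := by
    rw [← inner_neg_left, neg_sub]
  linarith [hA.nonneg hε (y - p)]

/-- Adding the optimality inequalities of the two projections, each tested at the other point, and
applying Cauchy–Schwarz. The right side involves only the projection for `(A, y)`, so it tends to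
zero as `(A', y')` tends to `(A, y)`; this yields continuity of the projection. -/
lemma mul_norm_genProj_sub_genProj_le {Θ : Set (E n)} (hΘ : IsCompact Θ) (hne : Θ.Nonempty)
    (hconv : Convex ℝ Θ) {ε : ℝ} {A A' : Matrix (Fin n) (Fin n) ℝ}
    (hA : A.IsSymm) (hA' : IsCoercive ε A') (y y' : E n) :
    ε * ‖genProj Θ A' y' - genProj Θ A y‖ ≤
      ‖act A (y - genProj Θ A y) - act A' (y' - genProj Θ A y)‖ := by
  have h1 := inner_act_sub_genProj_nonpos hΘ hconv hA y (genProj_spec hΘ hne A' y').1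
  have h2 := inner_act_sub_genProj_nonpos hΘ hconv hA'.symm y' (genProj_spec hΘ hne A y).1
  set p := genProj Θ A y
  set p' := genProj Θ A' y'
  have h3 : sqNormWrt A' (p' - p) ≤ ⟪p - p', act A (y - p) - act A' (y' - p)⟫ := by
    have e1 : act A' (y' - p') = act A' (y' - p) - act A' (p' - p) := by
      rw [← act_sub]; congr 1; abel
    rw [e1, inner_sub_right] at h2
    have e2 : p - p' = -(p' - p) := by abel
    rw [inner_sub_right, sqNormWrt_eq_inner]
    rw [e2] at h2 ⊢
    simp only [inner_neg_left] at h2 ⊢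
    linarith
  have h4 := hA'.le (p' - p)
  have h5 := real_inner_le_norm (p - p') (act A (y - p) - act A' (y' - p))
  rw [norm_sub_rev p p'] at h5
  rcases (norm_nonneg (p' - p)).eq_or_lt with h0 | h0
  · rw [← h0]; simp
  · refine le_of_mul_le_mul_right ?_ h0
    nlinarith

lemma continuous_genProj {Z : Type*} [TopologicalSpace Z] {Θ : Set (E n)} (hΘ : IsCompact Θ)
    (hne : Θ.Nonempty) (hconv : Convex ℝ Θ) {ε : ℝ} (hε : 0 < ε)
    {A : Z → Matrix (Fin n) (Fin n) ℝ} {y : Z → E n} (hA : Continuous A) (hy : Continuous y)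
    (hco : ∀ z, IsCoercive ε (A z)) : Continuous fun z => genProj Θ (A z) (y z) := by
  rw [continuous_iff_continuousAt]
  intro z
  rw [ContinuousAt, tendsto_iff_norm_sub_tendsto_zero]
  set p := InverseOpt.genProj Θ (A z) (y z)
  have hlim : Filter.Tendsto
      (fun z' => ε⁻¹ * ‖act (A z) (y z - p) - act (A z') (y z' - p)‖) (nhds z) (nhds 0) := by
    have : Continuous fun z' => ε⁻¹ * ‖act (A z) (y z - p) - act (A z') (y z' - p)‖ := by
      have := continuous_act.comp (hA.prodMk (hy.sub (continuous_const (y := p))))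
      exact continuous_const.mul (continuous_const.sub this).norm
    simpa using this.tendsto z
  refine squeeze_zero (fun _ => norm_nonneg _) (fun z' => ?_) hlim
  rw [inv_mul_eq_div, le_div_iff₀ hε, mul_comm]
  exact mul_norm_genProj_sub_genProj_le hΘ hne hconv (hco z).symm (hco z') (y z) (y z')

/-! ### The elliptical potential -/

/-- By the matrix determinant lemma, det A / det A' = 1 - ⟪d, A'⁻¹d⟫ for the rank-one update A' of
A; then log x ≤ x - 1. Summed over rounds, the bounds telescope. -/
lemma inner_act_inv_le_log_det_sub {ε : ℝ} (hε : 0 < ε) {A : Matrix (Fin n) (Fin n) ℝ}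
    (hA : IsCoercive ε A) (d : E n) :
    ⟪d, act (A + Matrix.vecMulVec d.ofLp d.ofLp)⁻¹ d⟫ ≤
      Real.log (A + Matrix.vecMulVec d.ofLp d.ofLp).det - Real.log A.det := by
  set A' := A + Matrix.vecMulVec d.ofLp d.ofLp with hA'
  have hpos : 0 < A.det := (hA.posDef hε).det_pos
  have hpos' : 0 < A'.det := ((hA.add_vecMulVec d).posDef hε).det_pos
  have hdet : A.det = A'.det * (1 - ⟪d, act A'⁻¹ d⟫) := by
    have e : A = A' + Matrix.replicateCol Unit (-d.ofLp) * Matrix.replicateRow Unit d.ofLp := by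
      rw [hA', ← Matrix.vecMulVec_eq, Matrix.neg_vecMulVec]; abel
    conv_lhs => rw [e]
    rw [Matrix.det_add_replicateCol_mul_replicateRow hpos'.ne'.isUnit]
    congr 1
    rw [Matrix.det_unique, inner_eq_dotProduct]
    simp only [act, Matrix.add_apply, Matrix.one_apply_eq]
    rw [Matrix.mul_assoc, Matrix.mul_apply_eq_vecMul]
    simp [Matrix.mul_apply, Matrix.vecMul, dotProduct, Matrix.mulVec, sub_eq_add_neg]
  have h1 : 1 - ⟪d, act A'⁻¹ d⟫ = A.det / A'.det := by
    rw [hdet]; field_simp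
  have h2 := Real.log_le_sub_one_of_pos (div_pos hpos hpos')
  rw [Real.log_div hpos.ne' hpos'.ne'] at h2
  linarith

/-- AM–GM for the eigenvalues, obtained from the tangent to the logarithm at their mean `m`. -/
lemma log_det_le {ε : ℝ} (hε : 0 < ε) (hn : 0 < n) {A : Matrix (Fin n) (Fin n) ℝ}
    (hA : A.PosDef) :
    Real.log A.det - n * Real.log ε ≤ n * Real.log (A.trace / (n * ε)) := by
  have hn' : (0 : ℝ) < n := by exact_mod_cast hn
  have : Nonempty (Fin n) := ⟨⟨0, hn⟩⟩
  have hev := hA.eigenvalues_pos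
  rw [hA.isHermitian.det_eq_prod_eigenvalues, hA.isHermitian.trace_eq_sum_eigenvalues]
  simp only [RCLike.ofReal_real_eq_id, id]
  set l := hA.isHermitian.eigenvalues
  have hsum : 0 < ∑ i, l i := Finset.sum_pos (fun i _ => hev i) Finset.univ_nonempty
  rw [Real.log_prod (fun i _ => (hev i).ne')]
  set m := (∑ i, l i) / n with hm
  have hmpos : 0 < m := by positivity
  have h : ∀ i, Real.log (l i) ≤ Real.log m + (l i / m - 1) := by
    intro i
    have := Real.log_le_sub_one_of_pos (div_pos (hev i) hmpos)
    rw [Real.log_div (hev i).ne' hmpos.ne'] at this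
    linarith
  have h2 : ∑ i, Real.log (l i) ≤ n * Real.log m := by
    refine (Finset.sum_le_sum fun i _ => h i).trans ?_
    rw [Finset.sum_add_distrib, Finset.sum_sub_distrib, ← Finset.sum_div]
    have : (∑ i, l i) / m = n := by rw [hm]; field_simp
    simp [this]
  have e : (∑ i, l i) / (n * ε) = m / ε := by rw [hm]; field_simp
  rw [e, Real.log_div hmpos.ne' hε.ne']
  linarith


/-! ### One step of ONS -/

lemma act_act_inv {A : Matrix (Fin n) (Fin n) ℝ} (hA : IsUnit A.det) (v : E n) :
    act A (act A⁻¹ v) = v := by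
  simp [act, Matrix.mulVec_mulVec, Matrix.mul_nonsing_inv A hA]

lemma onsStep_mat (Θ : Set (E n)) (γ : ℝ) (q : E n → ℝ) (s : ONSState n) :
    (onsStep Θ γ q s).mat = s.mat +
      Matrix.vecMulVec (gradient q s.point).ofLp (gradient q s.point).ofLp := rfl

lemma onsStep_point (Θ : Set (E n)) (γ : ℝ) (q : E n → ℝ) (s : ONSState n) :
    (onsStep Θ γ q s).point = genProj Θ (onsStep Θ γ q s).mat
      (s.point - (1 / γ) • act (onsStep Θ γ q s).mat⁻¹ (gradient q s.point)) := rfl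

lemma onsStep_trace (Θ : Set (E n)) (γ : ℝ) (q : E n → ℝ) (s : ONSState n) :
    (onsStep Θ γ q s).mat.trace = s.mat.trace + ‖gradient q s.point‖ ^ 2 := by
  rw [onsStep_mat, Matrix.trace_add, Matrix.trace_vecMulVec, ← inner_eq_dotProduct,
    real_inner_self_eq_norm_sq]

/-- Projecting does not increase the `A`-distance to `u`. Expanding the unprojected step, the linear
term matches `hq`, the rank-one update of `A` supplies its quadratic term, and the remaining ⟪d,
A⁻¹d⟫ is paid for by the growth of log det. -/
lemma onsStep_potential_le {Θ : Set (E n)} (hΘ : IsCompact Θ) (hconv : Convex ℝ Θ)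
    {ε γ : ℝ} (hε : 0 < ε) (hγ : 0 < γ) {q : E n → ℝ} {s : ONSState n}
    (hs : IsCoercive ε s.mat) {u : E n} (hu : u ∈ Θ)
    (hq : q s.point - q u ≤ ⟪gradient q s.point, s.point - u⟫ -
      γ / 2 * ⟪gradient q s.point, s.point - u⟫ ^ 2) :
    q s.point - q u + γ / 2 * sqNormWrt (onsStep Θ γ q s).mat ((onsStep Θ γ q s).point - u) -
        1 / (2 * γ) * Real.log (onsStep Θ γ q s).mat.det ≤
      γ / 2 * sqNormWrt s.mat (s.point - u) - 1 / (2 * γ) * Real.log s.mat.det := by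
  have hdet := inner_act_inv_le_log_det_sub hε hs (gradient q s.point)
  rw [← onsStep_mat Θ γ q s] at hdet
  have hco : IsCoercive ε (onsStep Θ γ q s).mat := hs.add_vecMulVec _
  have hsq := sqNormWrt_add_vecMulVec s.mat (gradient q s.point) (s.point - u)
  rw [← onsStep_mat Θ γ q s] at hsq
  have hproj := sqNormWrt_genProj_sub_le hΘ hconv hε.le hco
    (s.point - (1 / γ) • act (onsStep Θ γ q s).mat⁻¹ (gradient q s.point)) hu
  rw [← onsStep_point] at hproj
  set s' := onsStep Θ γ q s
  set d := gradient q s.point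
  have hunit : IsUnit s'.mat.det := (hco.posDef hε).det_pos.ne'.isUnit
  have e : s.point - (1 / γ) • act s'.mat⁻¹ d - u =
      (s.point - u) + (-(1 / γ)) • act s'.mat⁻¹ d := by
    rw [neg_smul]; abel
  rw [e, sqNormWrt_add hco.symm, sqNormWrt_smul, inner_smul_left, sqNormWrt_eq_inner _ (act _ _),
    act_act_inv hunit, inner_act_comm hco.symm, act_act_inv hunit, real_inner_comm d (act _ _),
    real_inner_comm d (s.point - u), conj_trivial, hsq] at hproj
  set a := ⟪d, s.point - u⟫
  set b := ⟪d, act s'.mat⁻¹ d⟫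
  have h1 := mul_le_mul_of_nonneg_left hproj (by positivity : 0 ≤ γ / 2)
  have h2 := mul_le_mul_of_nonneg_left hdet (by positivity : 0 ≤ 1 / (2 * γ))
  have h3 : γ / 2 * (sqNormWrt s.mat (s.point - u) + a ^ 2 + 2 * (-(1 / γ) * a) +
      (-(1 / γ)) ^ 2 * b) =
      γ / 2 * sqNormWrt s.mat (s.point - u) + γ / 2 * a ^ 2 - a + 1 / (2 * γ) * b := by
    field_simp; ring
  linarith

/-! ### The surrogate losses -/

lemma gradient_surrogate (η : ℝ) (c g w : E n) :
    gradient (surrogate η c g) w = (η * (1 - 2 * η * ⟪c - w, g⟫)) • g := by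
  refine HasGradientAt.gradient ?_
  rw [hasGradientAt_iff_hasFDerivAt]
  have h : HasFDerivAt (fun v : E n => ⟪c - v, g⟫) (-(InnerProductSpace.toDual ℝ (E n) g)) w := by
    have h0 := ((InnerProductSpace.toDual ℝ (E n) g).hasFDerivAt (x := w)).const_sub ⟪c, g⟫
    refine h0.congr_of_eventuallyEq (Filter.Eventually.of_forall fun v => ?_)
    simp [inner_sub_left, real_inner_comm]
  have h2 := (h.const_mul (-η)).add ((h.pow 2).const_mul (η ^ 2))
  unfold surrogate
  refine h2.congr_fderiv ?_
  ext v
  simp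
  ring

/-- The surrogate is quadratic along g: the left side equals the linear term minus (ηb)², with b =
⟪g, w - u⟫. The squared gradient term is (1 - 2ηs)²(ηb)², and γ(1 - 2ηs)² ≤ 1. -/
lemma surrogate_sub_le {η H γ : ℝ} (hη : 0 ≤ η)
    (hγ : γ ≤ 1 / (1 + 2 * η * H) ^ 2) {c g w : E n} (u : E n) (h : |⟪c - w, g⟫| ≤ H) :
    surrogate η c g w - surrogate η c g u ≤ ⟪gradient (surrogate η c g) w, w - u⟫ -
      γ / 2 * ⟪gradient (surrogate η c g) w, w - u⟫ ^ 2 := by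
  rw [gradient_surrogate, inner_smul_left]
  have hu : ⟪c - u, g⟫ = ⟪c - w, g⟫ + ⟪g, w - u⟫ := by
    rw [real_inner_comm (w - u) g, ← inner_add_left]; congr 1; abel
  simp only [surrogate, conj_trivial, hu]
  set s := ⟪c - w, g⟫
  set b := ⟪g, w - u⟫
  obtain ⟨h1, h2⟩ := abs_le.1 h
  have hH : 0 ≤ H := (abs_nonneg _).trans h
  have hηH : 0 ≤ η * H := mul_nonneg hη hH
  have hsq : (1 - 2 * η * s) ^ 2 ≤ (1 + 2 * η * H) ^ 2 := by
    have := mul_le_mul_of_nonneg_left h1 hη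
    have := mul_le_mul_of_nonneg_left h2 hη
    apply sq_le_sq'
    · nlinarith
    · nlinarith
  have hγ' : γ * (1 - 2 * η * s) ^ 2 ≤ 1 := by
    calc γ * (1 - 2 * η * s) ^ 2 ≤ 1 / (1 + 2 * η * H) ^ 2 * (1 + 2 * η * H) ^ 2 := by gcongr
      _ = 1 := by field_simp
  have : 0 ≤ (η * b) ^ 2 * (1 - γ * (1 - 2 * η * s) ^ 2) :=
    mul_nonneg (sq_nonneg _) (by linarith)
  nlinarith [sq_nonneg (η * b)]

/-- This is where the factor 5 in the grid enters: it keeps η⟪w - v, g⟫ within 1/5. -/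
lemma exp_sub_sq_le {x : ℝ} (h : |x| ≤ 1 / 5) : Real.exp (x - x ^ 2) ≤ 1 + x := by
  obtain ⟨h1, h2⟩ := abs_le.1 h
  rcases le_total 0 x with hx | hx
  · have hy : |x - x ^ 2| ≤ 1 := by rw [abs_le]; constructor <;> nlinarith
    have := (abs_le.1 (Real.abs_exp_sub_one_sub_id_le hy)).2
    nlinarith [mul_nonneg hx hx, mul_nonneg (mul_nonneg hx hx) hx]
  · obtain ⟨z, rfl⟩ : ∃ z, x = -z := ⟨-x, by ring⟩
    have hz : 0 ≤ z := by linarith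
    have hq := Real.quadratic_le_exp_of_nonneg (x := z + z ^ 2) (by positivity)
    have e : -z - (-z) ^ 2 = -(z + z ^ 2) := by ring
    rw [e, Real.exp_neg, inv_le_comm₀ (Real.exp_pos _) (by linarith)]
    refine le_trans ?_ hq
    rw [inv_le_iff_one_le_mul₀ (by linarith)]
    have hz5 : z ≤ 1 / 5 := by linarith
    have : 0 ≤ z ^ 2 * (1 / 2 - z / 2 - z ^ 2 / 2 - z ^ 3 / 2) := by
      refine mul_nonneg (sq_nonneg _) ?_
      have : z ^ 2 ≤ 1 / 5 * z := by nlinarith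
      have : z ^ 3 ≤ 1 / 5 * z ^ 2 := by nlinarith [sq_nonneg z]
      linarith
    nlinarith

lemma expertGamma_le {H η : ℝ} : expertGamma H η ≤ 1 / (1 + 2 * η * H) ^ 2 := by
  unfold expertGamma onsGamma
  have := min_le_right (1 / (η * H + 2 * η ^ 2 * H ^ 2)) (2 / (1 + 2 * η * H) ^ 2)
  calc _ ≤ 1 / 2 * (2 / (1 + 2 * η * H) ^ 2) := by gcongr
    _ = _ := by ring

/-- For ηH ≤ 1/5 the two candidates in the minimum are at least 25/7 and 50/49. With
`expertGamma_le_one`, γ lies in [1/2, 1], so it affects only absolute constants. -/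
lemma half_le_expertGamma {H η : ℝ} (h0 : 0 < η * H) (h : η * H ≤ 1 / 5) :
    1 / 2 ≤ expertGamma H η := by
  unfold expertGamma onsGamma
  have e1 : η * H + 2 * η ^ 2 * H ^ 2 = η * H + 2 * (η * H) ^ 2 := by ring
  have e2 : 2 * η * H = 2 * (η * H) := by ring
  rw [e1, e2]
  have : 1 ≤ min (1 / (η * H + 2 * (η * H) ^ 2)) (2 / (1 + 2 * (η * H)) ^ 2) := by
    refine le_min ?_ ?_
    · rw [le_div_iff₀ (by positivity)]; nlinarith
    · rw [le_div_iff₀ (by positivity)]; nlinarith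
  linarith

lemma expertGamma_le_one {H η : ℝ} (h0 : 0 < η * H) : expertGamma H η ≤ 1 := by
  refine expertGamma_le.trans ?_
  have : 1 ≤ 1 + 2 * η * H := by linarith
  rw [div_le_one (by positivity)]
  exact one_le_pow₀ this

lemma gridPoint_pos {H : ℝ} (hH : 0 < H) (i : ℕ) : 0 < gridPoint H i := by
  unfold gridPoint; positivity

lemma gridPoint_mul_le {H : ℝ} (hH : 0 < H) (i : ℕ) : gridPoint H i * H ≤ 1 / 5 := by
  have : gridPoint H i * H = ((2 : ℝ) ^ i)⁻¹ / 5 := by unfold gridPoint; field_simp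
  rw [this]
  have : ((2 : ℝ) ^ i)⁻¹ ≤ 1 := inv_le_one_of_one_le₀ (one_le_pow₀ (by norm_num))
  linarith

/-! ### Invariants of MetaGrad -/

section Invariants

variable {Θ : Set (E n)} {D B : ℝ} {w₁ : Fin (gridMax T + 1) → E n} (g : ℕ → E n)

/-- The regularization `n / (W² γ²)` of the expert with grid index `i`. -/
noncomputable def expertEps (n : ℕ) (D B : ℝ) (i : ℕ) : ℝ :=
  (n : ℝ) / (D ^ 2 * expertGamma B (gridPoint B i) ^ 2)

lemma expertGamma_gridPoint_pos (hB : 0 < B) (i : ℕ) : 0 < expertGamma B (gridPoint B i) :=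
  lt_of_lt_of_le (by norm_num)
    (half_le_expertGamma (mul_pos (gridPoint_pos hB i) hB) (gridPoint_mul_le hB i))

lemma expertEps_pos (hn : 0 < n) (hD : 0 < D) (hB : 0 < B) (i : ℕ) : 0 < expertEps n D B i := by
  have := expertGamma_gridPoint_pos hB i
  have : (0 : ℝ) < n := by exact_mod_cast hn
  unfold expertEps; positivity

lemma metaGradState_isCoercive (t : ℕ) (i : Fin (gridMax T + 1)) :
    IsCoercive (expertEps n D B i) ((metaGradState Θ D B w₁ g t).expert i).mat := by
  induction t with
  | zero => exact IsCoercive.smul_one _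
  | succ t ih => exact ih.add_vecMulVec _

lemma metaGradState_point_mem (hΘ : IsCompact Θ) (hw : ∀ i, w₁ i ∈ Θ) (t : ℕ)
    (i : Fin (gridMax T + 1)) : ((metaGradState Θ D B w₁ g t).expert i).point ∈ Θ := by
  cases t with
  | zero => exact hw i
  | succ t => exact (genProj_spec hΘ ⟨_, hw i⟩ _ _).1

lemma metaGradState_weight_pos (t : ℕ) (i : Fin (gridMax T + 1)) :
    0 < (metaGradState Θ D B w₁ g t).weight i := by
  induction t generalizing i with
  | zero => simp only [metaGradState, metaGradInit]; positivity
  | succ t ih =>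
    exact div_pos (mul_pos (ih i) (Real.exp_pos _))
      (Finset.sum_pos (fun j _ => mul_pos (ih j) (Real.exp_pos _)) Finset.univ_nonempty)

lemma sum_prior (m : ℕ) :
    ∑ i : Fin (m + 1), (1 + 1 / (1 + (m : ℝ))) / (((i : ℕ) + 1 : ℝ) * ((i : ℕ) + 2 : ℝ)) = 1 := by
  rw [Fin.sum_univ_eq_sum_range
    (fun i : ℕ => (1 + 1 / (1 + (m : ℝ))) / (((i : ℕ) + 1 : ℝ) * ((i : ℕ) + 2 : ℝ)))]
  simp_rw [div_eq_mul_inv (1 + 1 / (1 + (m : ℝ))) _]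
  rw [← Finset.mul_sum]
  have h : ∀ k : ℕ, ∑ i ∈ Finset.range k, (((i : ℕ) + 1 : ℝ) * ((i : ℕ) + 2 : ℝ))⁻¹ =
      (k : ℝ) / (k + 1) := by
    intro k
    induction k with
    | zero => simp
    | succ k ih => rw [Finset.sum_range_succ, ih]; push_cast; field_simp; ring
  rw [h]; push_cast; field_simp; ring

lemma metaGradState_sum_weight (t : ℕ) :
    ∑ i, (metaGradState (T := T) Θ D B w₁ g t).weight i = 1 := by
  cases t with
  | zero => exact sum_prior _
  | succ t =>
    simp only [metaGradState, MetaGradState.step]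
    rw [← Finset.sum_div, div_self]
    exact (Finset.sum_pos (fun j _ => mul_pos (metaGradState_weight_pos g t j) (Real.exp_pos _))
      Finset.univ_nonempty).ne'

lemma metaGrad_mem (hΘ : IsCompact Θ) (hconv : Convex ℝ Θ) (hB : 0 < B) (hw : ∀ i, w₁ i ∈ Θ)
    (t : ℕ) : metaGrad Θ D B w₁ g t ∈ Θ :=
  hconv.centerMass_mem (t := Finset.univ)
    (fun i _ => (mul_pos (gridPoint_pos hB i) (metaGradState_weight_pos g t i)).le)
    (Finset.sum_pos (fun i _ => mul_pos (gridPoint_pos hB i) (metaGradState_weight_pos g t i))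
      Finset.univ_nonempty)
    (fun i _ => metaGradState_point_mem g hΘ hw t i)

/-- Replace each exponential by 1 + x using `exp_sub_sq_le`. The point played is the ηp-weighted
mean of the experts, exactly so that the linear terms cancel. -/
lemma sum_weight_mul_exp_le_one (hΘ : IsCompact Θ) (hconv : Convex ℝ Θ) (hB : 0 < B)
    (hw : ∀ i, w₁ i ∈ Θ) (t : ℕ) (hg : ∀ c ∈ Θ, ∀ c' ∈ Θ, |⟪c - c', g t⟫| ≤ B) :
    ∑ i, (metaGradState Θ D B w₁ g t).weight i *
      Real.exp (-(surrogate (gridPoint B i) (metaGrad Θ D B w₁ g t) (g t)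
        ((metaGradState Θ D B w₁ g t).expert i).point)) ≤ 1 := by
  set s := metaGradState Θ D B w₁ g t with hs
  set c := metaGrad Θ D B w₁ g t with hc
  have h1 : ∀ i, s.weight i * Real.exp (-(surrogate (gridPoint B i) c (g t)
      (s.expert i).point)) ≤
      s.weight i + ⟪(gridPoint B i * s.weight i) • (c - (s.expert i).point), g t⟫ := by
    intro i
    have hb : |⟪c - (s.expert i).point, g t⟫| ≤ B :=
      hg c (metaGrad_mem g hΘ hconv hB hw t) _ (metaGradState_point_mem g hΘ hw t i)
    have hη := gridPoint_pos hB i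
    have hx : |gridPoint B i * ⟪c - (s.expert i).point, g t⟫| ≤ 1 / 5 := by
      rw [abs_mul, abs_of_pos hη]
      exact (mul_le_mul_of_nonneg_left hb hη.le).trans (gridPoint_mul_le hB i)
    have he := exp_sub_sq_le hx
    have e : -(surrogate (gridPoint B i) c (g t) (s.expert i).point) =
        gridPoint B i * ⟪c - (s.expert i).point, g t⟫ -
          (gridPoint B i * ⟪c - (s.expert i).point, g t⟫) ^ 2 := by
      unfold surrogate; ring
    rw [e, inner_smul_left, conj_trivial]
    have := mul_le_mul_of_nonneg_left he (metaGradState_weight_pos (Θ := Θ) (D := D) (B := B)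
      (w₁ := w₁) g t i).le
    rw [← hs] at this
    linarith
  refine (Finset.sum_le_sum fun i _ => h1 i).trans ?_
  rw [Finset.sum_add_distrib, metaGradState_sum_weight, ← sum_inner]
  have hz : ∑ i : Fin (gridMax T + 1),
      (gridPoint B i * s.weight i) • (c - (s.expert i).point) = 0 := by
    simp_rw [smul_sub]
    rw [Finset.sum_sub_distrib, ← Finset.sum_smul, hc, metaGrad, MetaGradState.play, ← hs,
      smul_inv_smul₀, sub_self]
    exact (Finset.sum_pos (fun (i : Fin (gridMax T + 1)) _ => mul_pos (gridPoint_pos hB i)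
      (metaGradState_weight_pos g t i)) Finset.univ_nonempty).ne'
  rw [hz]; simp

/-- The normalizer is at most 1, so normalizing can only raise the weights. -/
lemma log_weight_le_log_weight_succ (hΘ : IsCompact Θ) (hconv : Convex ℝ Θ) (hB : 0 < B)
    (hw : ∀ i, w₁ i ∈ Θ) (t : ℕ) (hg : ∀ c ∈ Θ, ∀ c' ∈ Θ, |⟪c - c', g t⟫| ≤ B)
    (i : Fin (gridMax T + 1)) :
    Real.log ((metaGradState Θ D B w₁ g t).weight i) -
      surrogate (gridPoint B i) (metaGrad Θ D B w₁ g t) (g t)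
        ((metaGradState Θ D B w₁ g t).expert i).point ≤
      Real.log ((metaGradState Θ D B w₁ g (t + 1)).weight i) := by
  have hZ := sum_weight_mul_exp_le_one (D := D) g hΘ hconv hB hw t hg
  have hpos := metaGradState_weight_pos (Θ := Θ) (D := D) (B := B) (w₁ := w₁) g t
  have hZ0 := Finset.sum_pos (fun j _ => mul_pos (hpos j) (Real.exp_pos
    (-(surrogate (gridPoint B j) (metaGrad Θ D B w₁ g t) (g t)
        ((metaGradState Θ D B w₁ g t).expert j).point)))) Finset.univ_nonempty
  have e : (metaGradState Θ D B w₁ g (t + 1)).weight i =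
      (metaGradState Θ D B w₁ g t).weight i *
        Real.exp (-(surrogate (gridPoint B i) (metaGrad Θ D B w₁ g t) (g t)
          ((metaGradState Θ D B w₁ g t).expert i).point)) /
      ∑ j, (metaGradState Θ D B w₁ g t).weight j *
        Real.exp (-(surrogate (gridPoint B j) (metaGrad Θ D B w₁ g t) (g t)
          ((metaGradState Θ D B w₁ g t).expert j).point)) := rfl
  rw [e, Real.log_div (mul_pos (hpos i) (Real.exp_pos _)).ne' hZ0.ne',
    Real.log_mul (hpos i).ne' (Real.exp_pos _).ne', Real.log_exp]
  linarith [Real.log_nonpos hZ0.le hZ]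

lemma metaGrad_potential_le (hn : 0 < n) (hD : 0 < D) (hB : 0 < B) (hΘ : IsCompact Θ)
    (hconv : Convex ℝ Θ) (hw : ∀ i, w₁ i ∈ Θ) {u : E n} (hu : u ∈ Θ)
    (i : Fin (gridMax T + 1)) (t : ℕ)
    (hg : ∀ s < t, ∀ c ∈ Θ, ∀ c' ∈ Θ, |⟪c - c', g s⟫| ≤ B) :
    ∑ s ∈ Finset.range t, -surrogate (gridPoint B i) (metaGrad Θ D B w₁ g s) (g s) u +
        expertGamma B (gridPoint B i) / 2 *
          sqNormWrt ((metaGradState Θ D B w₁ g t).expert i).mat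
            (((metaGradState Θ D B w₁ g t).expert i).point - u) -
        1 / (2 * expertGamma B (gridPoint B i)) *
          Real.log ((metaGradState Θ D B w₁ g t).expert i).mat.det -
        Real.log ((metaGradState Θ D B w₁ g t).weight i) ≤
      expertGamma B (gridPoint B i) / 2 *
          sqNormWrt ((metaGradState Θ D B w₁ g 0).expert i).mat (w₁ i - u) -
        1 / (2 * expertGamma B (gridPoint B i)) *
          Real.log ((metaGradState Θ D B w₁ g 0).expert i).mat.det -
        Real.log ((metaGradState Θ D B w₁ g 0).weight i) := by
  induction t with
  | zero => simp [metaGradState, metaGradInit, onsInit]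
  | succ t ih =>
    have ih' := ih fun s hs => hg s (hs.trans (Nat.lt_succ_self t))
    have hgt := hg t (Nat.lt_succ_self t)
    have hlog := log_weight_le_log_weight_succ (D := D) g hΘ hconv hB hw t hgt i
    have hγ := expertGamma_gridPoint_pos hB i
    have hons := onsStep_potential_le hΘ hconv (expertEps_pos hn hD hB i) hγ
      (q := surrogate (gridPoint B i) (metaGrad Θ D B w₁ g t) (g t))
      (metaGradState_isCoercive (Θ := Θ) (w₁ := w₁) g t i) hu
      (surrogate_sub_le (gridPoint_pos hB i).le expertGamma_le u
        (hgt _ (metaGrad_mem g hΘ hconv hB hw t) _ (metaGradState_point_mem g hΘ hw t i)))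
    have e : (metaGradState Θ D B w₁ g (t + 1)).expert i =
      onsStep Θ (expertGamma B (gridPoint B i))
        (surrogate (gridPoint B i) (metaGrad Θ D B w₁ g t) (g t))
        ((metaGradState Θ D B w₁ g t).expert i) := rfl
    rw [← e] at hons
    rw [Finset.sum_range_succ]
    linarith

lemma metaGradState_trace_le {K : ℝ} (hB : 0 < B) (hΘ : IsCompact Θ)
    (hconv : Convex ℝ Θ) (hw : ∀ i, w₁ i ∈ Θ) (i : Fin (gridMax T + 1)) (t : ℕ)
    (hg : ∀ s < t, ∀ c ∈ Θ, ∀ c' ∈ Θ, |⟪c - c', g s⟫| ≤ B) (hK : ∀ s < t, ‖g s‖ ≤ K) :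
    ((metaGradState Θ D B w₁ g t).expert i).mat.trace ≤
      n * expertEps n D B i + t * (7 / 25 * (K / B)) ^ 2 := by
  induction t with
  | zero => simp [metaGradState, metaGradInit, onsInit, expertEps, mul_comm]
  | succ t ih =>
    have ih' := ih (fun s hs => hg s (hs.trans (Nat.lt_succ_self t)))
      fun s hs => hK s (hs.trans (Nat.lt_succ_self t))
    have hKt := hK t (Nat.lt_succ_self t)
    have hη := gridPoint_pos hB i
    have hηB := gridPoint_mul_le hB i
    obtain ⟨hb1, hb2⟩ := abs_le.1 (hg t (Nat.lt_succ_self t) _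
      (metaGrad_mem (D := D) g hΘ hconv hB hw t)
      _ (metaGradState_point_mem g hΘ hw t i))
    have e : ((metaGradState Θ D B w₁ g (t + 1)).expert i).mat.trace = _ :=
      onsStep_trace Θ (expertGamma B (gridPoint B i))
        (surrogate (gridPoint B i) (metaGrad Θ D B w₁ g t) (g t))
        ((metaGradState Θ D B w₁ g t).expert i)
    rw [e, gradient_surrogate]
    set b := ⟪metaGrad Θ D B w₁ g t - ((metaGradState Θ D B w₁ g t).expert i).point, g t⟫
    have hnorm : ‖(gridPoint B i * (1 - 2 * gridPoint B i * b)) • g t‖ ≤ 7 / 25 * (K / B) := by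
      rw [norm_smul, Real.norm_eq_abs, abs_mul, abs_of_pos hη]
      -- From |b| ≤ B and ηB ≤ 1/5; with η ≤ 1/(5B) this produces the constant 7/25.
      have h1 : |1 - 2 * gridPoint B i * b| ≤ 7 / 5 := by
        rw [abs_le]; constructor <;> nlinarith
      have h2 : gridPoint B i ≤ 1 / (5 * B) := by
        rw [le_div_iff₀ (by positivity)]; linarith
      calc gridPoint B i * |1 - 2 * gridPoint B i * b| * ‖g t‖
          ≤ 1 / (5 * B) * (7 / 5) * K := by gcongr
        _ = _ := by field_simp; ring
    have := pow_le_pow_left₀ (norm_nonneg _) hnorm 2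
    push_cast
    linarith

lemma metaGrad_regret_le {K : ℝ} (hn : 0 < n) (hD : 0 < D) (hB : 0 < B) (hK0 : 0 < K)
    (hΘ : IsCompact Θ) (hconv : Convex ℝ Θ) (hdiam : ∀ c ∈ Θ, ∀ c' ∈ Θ, ‖c - c'‖ ≤ D)
    (hw : ∀ i, w₁ i ∈ Θ) {u : E n} (hu : u ∈ Θ) (i : Fin (gridMax T + 1)) (t : ℕ) (ht : 0 < t)
    (hg : ∀ s < t, ∀ c ∈ Θ, ∀ c' ∈ Θ, |⟪c - c', g s⟫| ≤ B) (hK : ∀ s < t, ‖g s‖ ≤ K) :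
    ∑ s ∈ Finset.range t, (gridPoint B i * ⟪metaGrad Θ D B w₁ g s - u, g s⟫ -
        gridPoint B i ^ 2 * ⟪metaGrad Θ D B w₁ g s - u, g s⟫ ^ 2) ≤
      n * Real.log (1 + (D * K * t / (B * n)) ^ 2) + n + 2 * Real.log (i + 2) := by
  have hn' : (0 : ℝ) < n := by exact_mod_cast hn
  have ht' : (1 : ℝ) ≤ t := by exact_mod_cast ht
  have hpot := metaGrad_potential_le g hn hD hB hΘ hconv hw hu i t hg
  have htr := metaGradState_trace_le (D := D) g hB hΘ hconv hw i t hg hK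
  have hco := metaGradState_isCoercive (Θ := Θ) (D := D) (B := B) (w₁ := w₁) g t i
  have hε := expertEps_pos hn hD hB i
  have hγ := expertGamma_gridPoint_pos hB i
  have hγ2 := half_le_expertGamma (mul_pos (gridPoint_pos hB i) hB) (gridPoint_mul_le hB i)
  have hγ1 := expertGamma_le_one (mul_pos (gridPoint_pos hB i) hB)
  have hdet := log_det_le hε hn (hco.posDef hε)
  have htrpos := @Matrix.PosDef.trace_pos _ _ _ _ _ _ _ _ ⟨⟨0, hn⟩⟩ _ (hco.posDef hε)
  have hdet0 : Real.log ((metaGradState Θ D B w₁ g 0).expert i).mat.det =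
      n * Real.log (expertEps n D B i) := by
    have : ((metaGradState Θ D B w₁ g 0).expert i).mat =
      expertEps n D B i • (1 : Matrix (Fin n) (Fin n) ℝ) := rfl
    rw [this, Matrix.det_smul, Matrix.det_one, mul_one, Real.log_pow, Fintype.card_fin]
  have hsq0 : expertGamma B (gridPoint B i) / 2 *
      sqNormWrt ((metaGradState Θ D B w₁ g 0).expert i).mat (w₁ i - u) ≤ n := by
    have : ((metaGradState Θ D B w₁ g 0).expert i).mat =
      expertEps n D B i • (1 : Matrix (Fin n) (Fin n) ℝ) := rfl
    rw [this, sqNormWrt_smul_one]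
    have hd := pow_le_pow_left₀ (norm_nonneg _) (hdiam _ (hw i) _ hu) 2
    calc expertGamma B (gridPoint B i) / 2 * (expertEps n D B i * ‖w₁ i - u‖ ^ 2)
        ≤ expertGamma B (gridPoint B i) / 2 * (expertEps n D B i * D ^ 2) := by gcongr
      _ = n * (1 / (2 * expertGamma B (gridPoint B i))) := by
          unfold expertEps; field_simp
      _ ≤ n * 1 := by
          gcongr
          rw [div_le_one (by positivity)]; linarith
      _ = n := mul_one _
  have hwt : Real.log ((metaGradState Θ D B w₁ g t).weight i) ≤ 0 := by
    refine Real.log_nonpos (metaGradState_weight_pos g t i).le ?_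
    rw [← metaGradState_sum_weight (Θ := Θ) (D := D) (B := B) (w₁ := w₁) g t]
    exact Finset.single_le_sum (f := (metaGradState Θ D B w₁ g t).weight)
      (fun j _ => (metaGradState_weight_pos g t j).le) (Finset.mem_univ i)
  have hw0 : -(2 * Real.log (i + 2)) ≤ Real.log ((metaGradState Θ D B w₁ g 0).weight i) := by
    have e : -(2 * Real.log ((i : ℝ) + 2)) = Real.log (1 / ((i : ℝ) + 2) ^ 2) := by
      rw [one_div, Real.log_inv, Real.log_pow]; norm_num
    rw [e]
    refine Real.log_le_log (by positivity) ?_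
    change _ ≤ (1 + 1 / (1 + (gridMax T : ℝ))) / (((i : ℕ) + 1 : ℝ) * ((i : ℕ) + 2 : ℝ))
    have h1 : (0 : ℝ) ≤ 1 / (1 + (gridMax T : ℝ)) := by positivity
    gcongr
    · linarith
    · nlinarith [(Nat.cast_nonneg (i : ℕ) : (0 : ℝ) ≤ ((i : ℕ) : ℝ))]
  have hratio : ((metaGradState Θ D B w₁ g t).expert i).mat.trace / (n * expertEps n D B i) ≤
      1 + (D * K * t / (B * n)) ^ 2 := by
    have h1 : ((t : ℝ) * (7 / 25 * (K / B)) ^ 2) / (n * expertEps n D B i) ≤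
        (D * K * t / (B * n)) ^ 2 := by
      have : ((t : ℝ) * (7 / 25 * (K / B)) ^ 2) / (n * expertEps n D B i) =
          t * ((7 / 25) ^ 2 * expertGamma B (gridPoint B i) ^ 2) * (D * K / (B * n)) ^ 2 := by
        unfold expertEps; field_simp
      rw [this]
      have hγsq : expertGamma B (gridPoint B i) ^ 2 ≤ 1 := pow_le_one₀ hγ.le hγ1
      -- A spare factor t ≥ 1 is given away to turn the bound into the square of DKt/(Bn); inside
      -- the logarithm this costs only a constant factor.
      calc _ ≤ (t : ℝ) * t * (D * K / (B * n)) ^ 2 := by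
            gcongr
            linarith
        _ = _ := by ring
    rw [div_le_iff₀ (by positivity)] at h1 ⊢
    linarith
  have hlog := Real.log_le_log (div_pos htrpos (by positivity)) hratio
  have hsum : ∑ s ∈ Finset.range t, (gridPoint B i * ⟪metaGrad Θ D B w₁ g s - u, g s⟫ -
        gridPoint B i ^ 2 * ⟪metaGrad Θ D B w₁ g s - u, g s⟫ ^ 2) =
      ∑ s ∈ Finset.range t, -surrogate (gridPoint B i) (metaGrad Θ D B w₁ g s) (g s) u :=
    Finset.sum_congr rfl fun s _ => by unfold surrogate; ring
  rw [hsum]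
  have hsqt := mul_nonneg (half_pos hγ).le
    (hco.nonneg hε.le (((metaGradState Θ D B w₁ g t).expert i).point - u))
  have hlogdet : 1 / (2 * expertGamma B (gridPoint B i)) *
      (Real.log ((metaGradState Θ D B w₁ g t).expert i).mat.det -
        n * Real.log (expertEps n D B i)) ≤ n * Real.log (1 + (D * K * t / (B * n)) ^ 2) := by
    have h1 : 1 / (2 * expertGamma B (gridPoint B i)) ≤ 1 := by
      rw [div_le_one (by positivity)]; linarith
    have h2 : 0 ≤ n * Real.log (1 + (D * K * t / (B * n)) ^ 2) :=
      mul_nonneg hn'.le (Real.log_nonneg (by nlinarith [sq_nonneg (D * K * t / (B * n))]))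
    calc _ ≤ 1 / (2 * expertGamma B (gridPoint B i)) *
          (n * Real.log (1 + (D * K * t / (B * n)) ^ 2)) := by
          gcongr
          exact hdet.trans (by gcongr)
      _ ≤ 1 * (n * Real.log (1 + (D * K * t / (B * n)) ^ 2)) := by gcongr
      _ = _ := one_mul _
  rw [hdet0] at hpot
  linarith

end Invariants


/-! ### Tuning the learning rate -/

lemma sqrt_eq_two_rpow {q : ℝ} (hq : 0 < q) : √q = (2 : ℝ) ^ (1 / 2 * Real.logb 2 q) := by
  rw [mul_comm, Real.rpow_mul (by norm_num), Real.rpow_logb (by norm_num) (by norm_num) hq,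
    Real.sqrt_eq_rpow]

lemma sqrt_le_two_pow_ceil (q : ℝ) : √q ≤ (2 : ℝ) ^ ⌈1 / 2 * Real.logb 2 q⌉₊ := by
  rcases le_or_gt q 0 with hq | hq
  · rw [Real.sqrt_eq_zero_of_nonpos hq]; positivity
  · rw [sqrt_eq_two_rpow hq, ← Real.rpow_natCast]
    exact Real.rpow_le_rpow_of_exponent_le (by norm_num) (Nat.le_ceil _)

/-- The summand 1 covers q ≤ 1, where the natural-number ceiling is 0. -/
lemma two_pow_ceil_le {q : ℝ} (hq : 0 ≤ q) :
    (2 : ℝ) ^ ⌈1 / 2 * Real.logb 2 q⌉₊ ≤ 2 * (1 + √q) := by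
  rcases le_or_gt q 1 with h | h
  · have : ⌈1 / 2 * Real.logb 2 q⌉₊ = 0 := by
      rw [Nat.ceil_eq_zero]
      have := Real.logb_nonpos (b := 2) (by norm_num) hq h
      linarith
    rw [this]
    nlinarith [Real.sqrt_nonneg q]
  · have hlog : 0 < Real.logb 2 q := Real.logb_pos (by norm_num) h
    have hc := Nat.ceil_lt_add_one (a := 1 / 2 * Real.logb 2 q) (by positivity)
    have : (2 : ℝ) ^ ⌈1 / 2 * Real.logb 2 q⌉₊ ≤ √q * 2 := by
      rw [sqrt_eq_two_rpow (by linarith), ← Real.rpow_natCast]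
      calc _ ≤ (2 : ℝ) ^ (1 / 2 * Real.logb 2 q + 1) :=
            Real.rpow_le_rpow_of_exponent_le (by norm_num) hc.le
        _ = _ := by rw [Real.rpow_add (by norm_num), Real.rpow_one]
    linarith

lemma half_logb_le {q x : ℝ} (hq : 0 ≤ q) (hx : 1 ≤ x) (h : q ≤ x) :
    1 / 2 * Real.logb 2 q ≤ 1 / 2 * Real.logb 2 x := by
  rcases hq.eq_or_lt with h0 | h0
  -- At q = 0 the logarithm takes its default value 0, so `1 ≤ x` is what makes the bound hold.
  · rw [← h0, Real.logb_zero]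
    have := Real.logb_nonneg (b := 2) (by norm_num) hx
    linarith
  · have := Real.logb_le_logb_of_le (b := 2) (by norm_num) h0 h
    linarith

/-- The prior cost of the chosen grid index. The true order is log log x, but a bound by log x is
enough beside n log ρ. -/
lemma log_ceil_add_two_le {q x : ℝ} (hq : 0 ≤ q) (hx : 1 ≤ x) (h : q ≤ x) :
    Real.log ((⌈1 / 2 * Real.logb 2 q⌉₊ : ℝ) + 2) ≤ 2 + Real.log x := by
  have h1 := half_logb_le hq hx h
  have h0 : 0 ≤ Real.log x := Real.log_nonneg hx
  have hl : 1 / 2 * Real.logb 2 x ≤ Real.log x := by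
    rw [Real.logb, ← mul_div_assoc, div_le_iff₀ (Real.log_pos (by norm_num))]
    nlinarith [Real.log_two_gt_d9]
  have h2 : (⌈1 / 2 * Real.logb 2 q⌉₊ : ℝ) ≤ Real.log x + 1 := by
    calc (⌈1 / 2 * Real.logb 2 q⌉₊ : ℝ) ≤ ⌈Real.log x⌉₊ := by
          exact_mod_cast Nat.ceil_le_ceil (h1.trans hl)
      _ ≤ _ := (Nat.ceil_lt_add_one h0).le
  have := Real.log_le_sub_one_of_pos (x := (⌈1 / 2 * Real.logb 2 q⌉₊ : ℝ) + 2) (by positivity)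
  linarith

lemma log_one_add_sq_le {x : ℝ} (hx : 1 ≤ x) : Real.log (1 + x ^ 2) ≤ 2 * Real.log x + 1 := by
  have h : 1 + x ^ 2 ≤ x ^ 2 * 2 := by nlinarith
  have := Real.log_le_log (by positivity) h
  rw [Real.log_mul (by positivity) (by norm_num), Real.log_pow] at this
  push_cast at this
  linarith [Real.log_two_lt_d9]

/-- The ideal rate has 1/η of order B·max(1, √q), where q = THδ/(B²L). The index is chosen from q
rather than T because the cost log(i + 2) must be absorbed by log ρ, and T may be far larger than ρ
when DK is small compared with B. -/
lemma sum_le_of_grid_bound {D K B Δ : ℝ} {r : ℕ → ℝ} (hn : 0 < n) (hT : 0 < T) (hD : 0 < D)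
    (hK0 : 0 < K) (hB : 0 < B) (hΔ : 0 ≤ Δ) (hρ : 1 ≤ D * K * T / (B * n))
    (hrD : ∀ t < T, |r t| ≤ D * K) (hrB : ∀ t < T, |r t| ≤ B) (hr : ∀ t < T, -Δ ≤ r t)
    (hgrid : ∀ i ≤ gridMax T, gridPoint B i * ∑ t ∈ Finset.range T, r t -
      gridPoint B i ^ 2 * ∑ t ∈ Finset.range T, r t ^ 2 ≤
        n * Real.log (1 + (D * K * T / (B * n)) ^ 2) + n + 2 * Real.log (i + 2)) :
    ∑ t ∈ Finset.range T, r t ≤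
      90 * (B * (n * (1 + Real.log (D * K * T / (B * n)))) +
        √(Δ * T * B * (n * (1 + Real.log (D * K * T / (B * n)))))) := by
  have hn' : (1 : ℝ) ≤ n := by exact_mod_cast hn
  have hT' : (1 : ℝ) ≤ T := by exact_mod_cast hT
  set ρ := D * K * T / (B * n) with hρdef
  have hlρ : 0 ≤ Real.log ρ := Real.log_nonneg hρ
  set L := n * (1 + Real.log ρ) with hL
  have hnL : (n : ℝ) ≤ L := by rw [hL]; nlinarith
  have hL1 : 1 ≤ L := hn'.trans hnL
  -- Both halves of the minimum matter: `H ≤ B` gives q ≤ T, so that the index lies in the grid, and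
  -- `H ≤ D * K` gives q ≤ ρ. Truncating Δ to δ ≤ H makes these bounds hold for arbitrarily large Δ.
  set H := min (D * K) B with hH
  have hHpos : 0 < H := lt_min (by positivity) hB
  have hHB : H ≤ B := min_le_right _ _
  have hHD : H ≤ D * K := min_le_left _ _
  set δ := min Δ H with hδ
  have hδ0 : 0 ≤ δ := le_min hΔ hHpos.le
  have hδΔ : δ ≤ Δ := min_le_left _ _
  have hδH : δ ≤ H := min_le_right _ _
  have hrH : ∀ t < T, |r t| ≤ H := fun t ht => le_min (hrD t ht) (hrB t ht)
  have hrδ : ∀ t < T, -δ ≤ r t := by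
    intro t ht
    rw [hδ]
    rcases min_choice Δ H with h | h <;> rw [h]
    · exact hr t ht
    · exact (abs_le.1 (hrH t ht)).1
  set R := ∑ t ∈ Finset.range T, r t with hR
  set V := ∑ t ∈ Finset.range T, r t ^ 2 with hV
  have hVle : V ≤ H * (R + 2 * (T * δ)) := by
    have : ∀ t ∈ Finset.range T, r t ^ 2 ≤ H * (r t + 2 * δ) := by
      intro t ht
      have ht' := Finset.mem_range.1 ht
      have h1 := hrδ t ht'
      have h2 : |r t| ≤ r t + 2 * δ := by rw [abs_le]; constructor <;> linarith
      calc r t ^ 2 = |r t| * |r t| := by rw [← sq, sq_abs]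
        _ ≤ H * (r t + 2 * δ) := mul_le_mul (hrH t ht') h2 (abs_nonneg _) hHpos.le
    refine (Finset.sum_le_sum this).trans_eq ?_
    rw [← Finset.mul_sum, Finset.sum_add_distrib]
    rw [Finset.sum_const, Finset.card_range, nsmul_eq_mul]; ring
  rcases le_or_gt R 0 with hR0 | hR0
  · exact hR0.trans (by positivity)
  set Q := T * H * δ with hQ
  have hQ0 : 0 ≤ Q := by positivity
  set q := Q / (B ^ 2 * L) with hq
  have hq0 : 0 ≤ q := by positivity
  have hQB : Q ≤ T * B ^ 2 := by
    calc Q ≤ T * B * B := by rw [hQ]; gcongr; linarith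
      _ = _ := by ring
  have hqT : q ≤ T := by
    rw [hq, div_le_iff₀ (by positivity)]
    calc Q ≤ T * B ^ 2 * 1 := by linarith
      _ ≤ T * B ^ 2 * L := by gcongr
      _ = _ := by ring
  have hqρ : q ≤ ρ := by
    rw [hq, div_le_iff₀ (by positivity)]
    calc Q ≤ T * (D * K) * B := by rw [hQ]; gcongr; linarith
      _ = ρ * (B ^ 2 * n) := by rw [hρdef]; field_simp
      _ ≤ ρ * (B ^ 2 * L) := by gcongr
  set i := ⌈1 / 2 * Real.logb 2 q⌉₊ with hi
  have him : i ≤ gridMax T := Nat.ceil_le_ceil (half_logb_le hq0 hT' hqT)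
  have hreg := hgrid i him
  have hηpos := gridPoint_pos hB i
  have hηB := gridPoint_mul_le hB i
  have hlog1 := log_one_add_sq_le hρ
  have hlog2 := log_ceil_add_two_le hq0 hρ hqρ
  rw [← hi] at hlog2
  -- The cost is at most n(2 log ρ + 1) + n + 2(2 + log ρ), and n ≥ 1.
  have h7 : gridPoint B i * R - gridPoint B i ^ 2 * V ≤ 7 * L := by
    have := mul_le_mul_of_nonneg_left hlog1 (by linarith : (0 : ℝ) ≤ n)
    have : Real.log ρ ≤ n * Real.log ρ := le_mul_of_one_le_left hlρ hn'
    rw [hL]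
    linarith
  have hs1 : √q ≤ (2 : ℝ) ^ i := sqrt_le_two_pow_ceil q
  have hs2 : (2 : ℝ) ^ i ≤ 2 * (1 + √q) := two_pow_ceil_le hq0
  have hqs : √q ^ 2 = q := Real.sq_sqrt hq0
  set z := √q
  have hz0 : 0 ≤ z := Real.sqrt_nonneg q
  have hQz : Q = z ^ 2 * (B ^ 2 * L) := by rw [hqs, hq]; field_simp
  have h2i : (0 : ℝ) < 2 ^ i := by positivity
  have hη : gridPoint B i = 1 / (2 ^ i * (5 * B)) := by unfold gridPoint; field_simp
  -- Since ηH ≤ 1/5, the part of ηV proportional to R is absorbed on the left.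
  have hmain : 4 / 5 * R ≤ 7 * L * (2 ^ i * (5 * B)) + 2 * (gridPoint B i * Q) := by
    have h1 : R - gridPoint B i * V ≤ 7 * L * (2 ^ i * (5 * B)) := by
      have e : R - gridPoint B i * V =
          (gridPoint B i * R - gridPoint B i ^ 2 * V) * (2 ^ i * (5 * B)) := by
        rw [hη]; field_simp
      rw [e]; gcongr
    have h2 : gridPoint B i * V ≤ gridPoint B i * (H * (R + 2 * (T * δ))) := by gcongr
    have h3 : gridPoint B i * (H * R) ≤ 1 / 5 * R := by
      rw [← mul_assoc]
      gcongr
      exact (mul_le_mul_of_nonneg_left hHB hηpos.le).trans hηB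
    rw [hQ]
    linarith
  have hηQ : gridPoint B i * Q ≤ B * L * z / 5 := by
    have : gridPoint B i * Q = B * L * z / 5 * (z / 2 ^ i) := by
      rw [hη, hQz]; field_simp
    rw [this]
    exact mul_le_of_le_one_right (by positivity) ((div_le_one h2i).2 hs1)
  have hfirst : 7 * L * (2 ^ i * (5 * B)) ≤ 7 * L * (2 * (1 + z) * (5 * B)) := by gcongr
  have hzs : B * L * z ≤ √(Δ * T * B * L) := by
    apply Real.le_sqrt_of_sq_le
    calc (B * L * z) ^ 2 = Q * L := by rw [hQz]; ring
      _ ≤ T * B * Δ * L := by rw [hQ]; gcongr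
      _ = _ := by ring
  have : 0 ≤ B * L := by positivity
  linarith

lemma metaGrad_sum_le {Θ : Set (E n)} {D K B Δ : ℝ} {w₁ : Fin (gridMax T + 1) → E n}
    {g : ℕ → E n} (hn : 0 < n) (hT : 0 < T) (hD : 0 < D) (hK0 : 0 < K) (hB : 0 < B)
    (hΔ : 0 ≤ Δ) (hρ : 1 ≤ D * K * T / (B * n)) (hΘ : IsCompact Θ) (hconv : Convex ℝ Θ)
    (hdiam : ∀ c ∈ Θ, ∀ c' ∈ Θ, ‖c - c'‖ ≤ D) (hw : ∀ i, w₁ i ∈ Θ) {u : E n} (hu : u ∈ Θ)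
    (hg : ∀ t < T, ∀ c ∈ Θ, ∀ c' ∈ Θ, |⟪c - c', g t⟫| ≤ B) (hK : ∀ t < T, ‖g t‖ ≤ K)
    (hr : ∀ t < T, -Δ ≤ ⟪metaGrad Θ D B w₁ g t - u, g t⟫) :
    ∑ t ∈ Finset.range T, ⟪metaGrad Θ D B w₁ g t - u, g t⟫ ≤
      90 * (B * (n * (1 + Real.log (D * K * T / (B * n)))) +
        √(Δ * T * B * (n * (1 + Real.log (D * K * T / (B * n)))))) := by
  have key := sum_le_of_grid_bound (r := fun t => ⟪metaGrad Θ D B w₁ g t - u, g t⟫)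
    hn hT hD hK0 hB hΔ hρ (fun t ht => ?_)
    (fun t ht => hg t ht _ (metaGrad_mem g hΘ hconv hB hw t) _ hu) hr (fun i hi => ?_)
  · exact key
  · exact (abs_real_inner_le_norm _ _).trans
      (mul_le_mul (hdiam _ (metaGrad_mem g hΘ hconv hB hw t) _ hu) (hK t ht) (norm_nonneg _) hD.le)
  · have hreg := metaGrad_regret_le g hn hD hB hK0 hΘ hconv hdiam hw hu
      (⟨i, Nat.lt_succ_of_le hi⟩ : Fin (gridMax T + 1)) T hT hg hK
    rw [Finset.sum_sub_distrib, ← Finset.mul_sum, ← Finset.mul_sum] at hreg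
    exact hreg


/-! ### Continuity and measurability of MetaGrad -/

section Continuity

variable {Θ : Set (E n)} {D B : ℝ} {w₁ : Fin (gridMax T + 1) → E n}

lemma continuous_act_inv {Z : Type*} [TopologicalSpace Z] {A : Z → Matrix (Fin n) (Fin n) ℝ}
    {v : Z → E n} (hA : Continuous A) (hv : Continuous v) (h : ∀ z, (A z).det ≠ 0) :
    Continuous fun z => act (A z)⁻¹ (v z) := by
  have hinv : Continuous fun z => (A z)⁻¹ := by
    simp_rw [Matrix.inv_def, Ring.inverse_eq_inv']
    exact (hA.matrix_det.inv₀ h).smul hA.matrix_adjugate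
  exact continuous_act.comp (hinv.prodMk hv)

lemma MetaGradState.continuous_play {Z : Type*} [TopologicalSpace Z] {s : Z → MetaGradState n T}
    (hB : 0 < B) (hpos : ∀ z i, 0 < (s z).weight i)
    (hp : ∀ i, Continuous fun z => ((s z).expert i).point)
    (hw : ∀ i, Continuous fun z => (s z).weight i) :
    Continuous fun z => (s z).play B := by
  unfold MetaGradState.play
  have h1 : Continuous fun z => ∑ i : Fin (gridMax T + 1), gridPoint B i * (s z).weight i :=
    continuous_finsetSum _ fun i _ => continuous_const.mul (hw i)
  have h2 : Continuous fun z => ∑ i : Fin (gridMax T + 1),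
      (gridPoint B i * (s z).weight i) • ((s z).expert i).point :=
    continuous_finsetSum _ fun i _ => (continuous_const.mul (hw i)).smul (hp i)
  refine (h1.inv₀ fun z => ?_).smul h2
  exact (Finset.sum_pos (fun (i : Fin (gridMax T + 1)) _ => mul_pos (gridPoint_pos hB i)
    (hpos z i)) Finset.univ_nonempty).ne'

/-- Continuity in the whole gradient sequence is the route to measurability of the predictions. The
projection is continuous because the matrices stay uniformly coercive. -/
lemma continuous_metaGradState (hn : 0 < n) (hD : 0 < D) (hB : 0 < B) (hΘ : IsCompact Θ)
    (hconv : Convex ℝ Θ) (hw : ∀ i, w₁ i ∈ Θ) (t : ℕ) (i : Fin (gridMax T + 1)) :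
    (Continuous fun g : ℕ → E n => ((metaGradState Θ D B w₁ g t).expert i).point) ∧
    (Continuous fun g : ℕ → E n => ((metaGradState Θ D B w₁ g t).expert i).mat) ∧
    Continuous fun g : ℕ → E n => (metaGradState Θ D B w₁ g t).weight i := by
  induction t generalizing i with
  | zero => exact ⟨continuous_const, continuous_const, continuous_const⟩
  | succ t ih =>
    have hplay : Continuous fun g : ℕ → E n => metaGrad Θ D B w₁ g t :=
      MetaGradState.continuous_play hB (fun g => metaGradState_weight_pos g t)
        (fun i => (ih i).1) fun i => (ih i).2.2
    have hg : Continuous fun g : ℕ → E n => g t := continuous_apply t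
    have hinner : ∀ i, Continuous fun g : ℕ → E n =>
        ⟪metaGrad Θ D B w₁ g t - ((metaGradState Θ D B w₁ g t).expert i).point, g t⟫ :=
      fun i => (hplay.sub (ih i).1).inner hg
    have hgrad : Continuous fun g : ℕ → E n =>
        gradient (surrogate (gridPoint B i) (metaGrad Θ D B w₁ g t) (g t))
          ((metaGradState Θ D B w₁ g t).expert i).point := by
      simp_rw [gradient_surrogate]
      have := hinner i
      fun_prop
    have hmat : Continuous fun g : ℕ → E n =>
        ((metaGradState Θ D B w₁ g (t + 1)).expert i).mat := by
      refine (ih i).2.1.add (Continuous.matrix_vecMulVec ?_ ?_) <;>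
      exact (PiLp.continuous_ofLp 2 _).comp hgrad
    have hco := fun g : ℕ → E n =>
      metaGradState_isCoercive (Θ := Θ) (D := D) (B := B) (w₁ := w₁) g (t + 1) i
    have hε := expertEps_pos hn hD hB i
    refine ⟨?_, hmat, ?_⟩
    · refine continuous_genProj hΘ ⟨_, hw i⟩ hconv hε hmat ?_ hco
      exact (ih i).1.sub ((continuous_act_inv hmat hgrad fun g =>
        ((hco g).posDef hε).det_pos.ne').const_smul (1 / expertGamma B (gridPoint B i)))
    · have hterm : ∀ i, Continuous fun g : ℕ → E n => (metaGradState Θ D B w₁ g t).weight i *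
          Real.exp (-(surrogate (gridPoint B i) (metaGrad Θ D B w₁ g t) (g t)
            ((metaGradState Θ D B w₁ g t).expert i).point)) := by
        intro i
        have h1 := hinner i
        have h2 := (ih i).2.2
        unfold surrogate
        fun_prop
      refine (hterm i).div (continuous_finsetSum _ fun j _ => hterm j) fun g => ?_
      exact (Finset.sum_pos (fun j _ => mul_pos (metaGradState_weight_pos g t j)
        (Real.exp_pos _)) Finset.univ_nonempty).ne'

lemma continuous_metaGrad (hn : 0 < n) (hD : 0 < D) (hB : 0 < B) (hΘ : IsCompact Θ)
    (hconv : Convex ℝ Θ) (hw : ∀ i, w₁ i ∈ Θ) (t : ℕ) :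
    Continuous fun g : ℕ → E n => metaGrad Θ D B w₁ g t :=
  MetaGradState.continuous_play hB (fun g => metaGradState_weight_pos g t)
    (fun i => (continuous_metaGradState hn hD hB hΘ hconv hw t i).1)
    fun i => (continuous_metaGradState hn hD hB hΘ hconv hw t i).2.2

lemma metaGradState_congr {g g' : ℕ → E n} {t : ℕ} (h : ∀ s < t, g s = g' s) :
    metaGradState Θ D B w₁ g t = metaGradState Θ D B w₁ g' t := by
  induction t with
  | zero => rfl
  | succ t ih =>
    simp only [metaGradState]
    rw [ih fun s hs => h s (hs.trans (Nat.lt_succ_self t)), h t (Nat.lt_succ_self t)]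

lemma measurable_metaGrad {Ω : Type*} {m : MeasurableSpace Ω} (hn : 0 < n) (hD : 0 < D)
    (hB : 0 < B) (hΘ : IsCompact Θ) (hconv : Convex ℝ Θ) (hw : ∀ i, w₁ i ∈ Θ) (t : ℕ)
    {g : ℕ → Ω → E n} (hg : ∀ s < t, Measurable (g s)) :
    Measurable fun ω => metaGrad Θ D B w₁ (fun s => g s ω) t := by
  -- Gradients from round `t` on are not assumed measurable; they do not affect the output and are
  -- set to 0.
  have e : (fun ω => metaGrad Θ D B w₁ (fun s => g s ω) t) =
      (fun g : ℕ → E n => metaGrad Θ D B w₁ g t) ∘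
        fun ω s => if s < t then g s ω else 0 := by
    funext ω
    simp only [Function.comp, metaGrad]
    rw [metaGradState_congr fun s hs => (if_pos hs).symm]
  rw [e]
  refine (continuous_metaGrad hn hD hB hΘ hconv hw t).measurable.comp
    (measurable_pi_lambda _ fun s => ?_)
  by_cases hs : s < t
  · simpa [hs] using hg s hs
  · simp [hs]

end Continuity

/-! ### The suboptimality loss -/

/-- The supremum is attained, so exceeding `a` means meeting the open ray above `a`, and staying
below `a` means lying inside the open ray below it. Both conditions are open on compact sets. -/
lemma continuous_sSup_nonemptyCompacts :
    Continuous fun K : NonemptyCompacts ℝ => sSup (K : Set ℝ) := by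
  rw [OrderTopology.continuous_iff]
  intro a
  have hlub : ∀ K : NonemptyCompacts ℝ, IsLUB (K : Set ℝ) (sSup (K : Set ℝ)) :=
    fun K => K.isCompact.isLUB_sSup K.nonempty
  have hmem : ∀ K : NonemptyCompacts ℝ, sSup (K : Set ℝ) ∈ (K : Set ℝ) :=
    fun K => K.isCompact.sSup_mem K.nonempty
  constructor
  · convert NonemptyCompacts.isOpen_inter_nonempty_of_isOpen (isOpen_Ioi (a := a)) using 1
    ext K
    constructor
    · exact fun h => ⟨_, hmem K, h⟩
    · rintro ⟨x, hx, hax⟩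
      exact lt_of_lt_of_le hax ((hlub K).1 hx)
  · convert NonemptyCompacts.isOpen_subsets_of_isOpen (isOpen_Iio (a := a)) using 1
    ext K
    constructor
    · exact fun h x hx => lt_of_le_of_lt ((hlub K).1 hx) h
    · exact fun h => h (hmem K)

lemma continuous_support_function :
    Continuous fun p : NonemptyCompacts (E n) × E n =>
      sSup ((fun x' : E n => ⟪p.2, x'⟫) '' (p.1 : Set (E n))) := by
  have h : Continuous fun p : NonemptyCompacts (E n) × E n =>
      p.1.map (fun x' : E n => ⟪p.2, x'⟫) (by fun_prop) :=
    Continuous.nonemptyCompacts_map' (g := fun (p : NonemptyCompacts (E n) × E n) x' => ⟪p.2, x'⟫)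
      continuous_fst (by unfold Function.uncurry; fun_prop)
  exact continuous_sSup_nonemptyCompacts.comp h

lemma measurable_comp_comap_borel {α β γ : Type*} [TopologicalSpace α] [TopologicalSpace β]
    [SecondCountableTopology β] [MeasurableSpace β] [BorelSpace β] (f : γ → α) {F : α × β → ℝ}
    (hF : Continuous F) :
    @Measurable (β × γ) ℝ (@Prod.instMeasurableSpace _ _ _ ((borel α).comap f)) _
      fun p => F (f p.2, p.1) := by
  let _ : MeasurableSpace α := borel α
  have _ : BorelSpace α := ⟨rfl⟩
  let _ : MeasurableSpace γ := (borel α).comap f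
  have h2 : Measurable f := comap_measurable _
  exact hF.measurable.comp ((h2.comp measurable_snd).prodMk measurable_fst)

lemma measurable_suboptLoss :
    Measurable fun p : E n × Observation n => suboptLoss p.2 p.1 := by
  have h1 : Continuous fun p : (NonemptyCompacts (E n) × E n) × E n =>
      sSup ((fun x' : E n => ⟪p.2, x'⟫) '' (p.1.1 : Set (E n))) - ⟪p.2, p.1.2⟫ := by
    have h := continuous_support_function.comp
      ((continuous_fst.comp continuous_fst).prodMk continuous_snd :
        Continuous fun p : (NonemptyCompacts (E n) × E n) × E n => (p.1.1, p.2))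
    exact h.sub (continuous_snd.inner (continuous_snd.comp continuous_fst))
  exact measurable_comp_comap_borel (fun o : Observation n => (o.X, o.x)) h1

lemma Observation.measurable_x : Measurable fun o : Observation n => o.x := by
  let _ : MeasurableSpace (NonemptyCompacts (E n) × E n) := borel _
  have _ : BorelSpace (NonemptyCompacts (E n) × E n) := ⟨rfl⟩
  have h2 : Measurable fun o : Observation n => (o.X, o.x) := comap_measurable _
  have h1 : Continuous (Prod.snd : NonemptyCompacts (E n) × E n → E n) := continuous_snd
  exact h1.measurable.comp h2

lemma inner_sub_le_suboptLoss (o : Observation n) (c : E n) {y : E n} (hy : y ∈ o.X) :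
    ⟪c, y - o.x⟫ ≤ suboptLoss o c := by
  have hK : IsCompact ((fun x' : E n => ⟪c, x'⟫) '' (o.X : Set (E n))) :=
    o.X.isCompact.image (by fun_prop)
  rw [inner_sub_right, suboptLoss]
  gcongr
  exact le_csSup hK.bddAbove (Set.mem_image_of_mem (fun x' : E n => ⟪c, x'⟫) hy)

lemma suboptLoss_nonneg (o : Observation n) (c : E n) : 0 ≤ suboptLoss o c := by
  simpa using inner_sub_le_suboptLoss o c o.mem

lemma exists_suboptLoss_eq (o : Observation n) (c : E n) :
    ∃ y ∈ o.X, suboptLoss o c = ⟪c, y - o.x⟫ := by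
  obtain ⟨y, hy, h⟩ := o.X.isCompact.exists_sSup_image_eq o.X.nonempty
    (f := fun x' : E n => ⟪c, x'⟫) (by fun_prop)
  exact ⟨y, hy, by rw [suboptLoss, h, inner_sub_right]⟩

lemma suboptLoss_eq_of_mem_linArgmax (o : Observation n) {c y : E n}
    (hy : y ∈ linArgmax (o.X : Set (E n)) c) : suboptLoss o c = ⟪c, y - o.x⟫ := by
  refine le_antisymm ?_ (inner_sub_le_suboptLoss o c hy.1)
  obtain ⟨z, hz, h⟩ := exists_suboptLoss_eq o c
  rw [h, inner_sub_right, inner_sub_right]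
  linarith [hy.2 z hz]

/-- Jensen for a maximum of linear functions: a maximizer for the average is a competitor for every
`c t`. -/
lemma suboptLoss_average_le (o : Observation n) (hT : 0 < T) (c : ℕ → E n) :
    suboptLoss o ((1 / (T : ℝ)) • ∑ t ∈ Finset.range T, c t) ≤
      1 / (T : ℝ) * ∑ t ∈ Finset.range T, suboptLoss o (c t) := by
  obtain ⟨y, hy, h⟩ := exists_suboptLoss_eq o ((1 / (T : ℝ)) • ∑ t ∈ Finset.range T, c t)
  rw [h, inner_smul_left, conj_trivial, sum_inner]
  gcongr with t
  exact inner_sub_le_suboptLoss o (c t) hy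

lemma abs_suboptLoss_sub_le {o : Observation n} {c c' : E n} {B Δ : ℝ} (hB : 0 ≤ B)
    (h : ∀ x ∈ o.X, ∀ x' ∈ o.X, ⟪c - c', x - x'⟫ ≤ B) (hΔ : suboptLoss o c' ≤ Δ) :
    |suboptLoss o c - suboptLoss o c'| ≤ B + Δ := by
  have h0 := suboptLoss_nonneg o c
  have h0' := suboptLoss_nonneg o c'
  obtain ⟨y, hy, hc⟩ := exists_suboptLoss_eq o c
  have h1 := inner_sub_le_suboptLoss o c' hy
  have h2 := h y hy o.x o.mem
  rw [inner_sub_left] at h2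
  rw [abs_le]
  constructor <;> linarith

/-! ### From online regret to expected excess loss -/

/-- Independence makes the joint law of `c` and `o` a product, so a fresh draw from `μ` may replace
`o`. -/
lemma integral_prod_eq_of_indepFun {Ω α β : Type*} [MeasurableSpace Ω] [MeasurableSpace α]
    [MeasurableSpace β] {P : Measure Ω} [IsProbabilityMeasure P] {μ : Measure β}
    [IsProbabilityMeasure μ] {c : Ω → α} {o : Ω → β} (hc : Measurable c) (ho : Measurable o)
    (hmap : P.map o = μ) (hind : IndepFun c o P) {φ : α × β → ℝ} (hφ : Measurable φ) :
    ∫ p : Ω × β, φ (c p.1, p.2) ∂(P.prod μ) = ∫ ω, φ (c ω, o ω) ∂P := by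
  have h1 := hind.map_prod_eq_prod_map_map hc.aemeasurable ho.aemeasurable
  have h2 := Measure.map_prod_map P μ hc measurable_id
  rw [Measure.map_id] at h2
  rw [hmap, h2] at h1
  have e1 : ∫ p, φ p ∂((P.prod μ).map (Prod.map c id)) = ∫ p, φ (c p.1, p.2) ∂(P.prod μ) :=
    integral_map (hc.prodMap measurable_id).aemeasurable hφ.aestronglyMeasurable
  have e2 : ∫ p, φ p ∂(P.map fun ω => (c ω, o ω)) = ∫ ω, φ (c ω, o ω) ∂P :=
    integral_map (hc.prodMk ho).aemeasurable hφ.aestronglyMeasurable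
  rw [← e1, ← h1, e2]

/-- The history before round `t` is independent of the observation of round `t`. -/
lemma indepFun_of_measurable_history {Ω α β : Type*} [MeasurableSpace Ω] [MeasurableSpace α]
    [MeasurableSpace β] {P : Measure Ω} {o : ℕ → Ω → β} (ho : ∀ t < T, Measurable (o t))
    (hind : iIndepFun (fun t : Fin T => o t) P) {t : ℕ} (ht : t < T) {c : Ω → α}
    (hc : Measurable[⨆ s ∈ Set.Iio t, MeasurableSpace.comap (o s) inferInstance] c) :
    IndepFun c (o t) P := by
  have h := indep_iSup_of_disjoint (m := fun s : Fin T => MeasurableSpace.comap (o s) inferInstance)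
    (fun s => (ho s s.2).comap_le) hind
    (S := Set.Iio ⟨t, ht⟩) (T := {⟨t, ht⟩}) (by simp)
  rw [IndepFun_iff_Indep]
  refine indep_of_indep_of_le_left (indep_of_indep_of_le_right h ?_) ?_
  · exact le_iSup₂_of_le (⟨t, ht⟩ : Fin T) rfl le_rfl
  · refine hc.comap_le.trans (iSup₂_le fun s hs => ?_)
    exact le_iSup₂_of_le (⟨s, lt_trans hs ht⟩ : Fin T) hs le_rfl


/-- Only here is ρ bounded away from 1: it gives 1 + log ρ ≤ κ log ρ. Under the root κ ≤ κ² allows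
the same constant for both terms. -/
lemma rate_le {ρ₀ ρ n T B Δ : ℝ} (hρ₀ : 1 < ρ₀) (hn : 0 < n) (hT : 0 < T) (hB : 0 ≤ B)
    (hΔ : 0 ≤ Δ) (hρ : ρ₀ ≤ ρ) :
    1 / T * (90 * (B * (n * (1 + Real.log ρ)) + √(Δ * T * B * (n * (1 + Real.log ρ))))) ≤
      90 * (1 + 1 / Real.log ρ₀) *
        (B * n / T * Real.log ρ + √(Δ * B * n / T * Real.log ρ)) := by
  have hl₀ : 0 < Real.log ρ₀ := Real.log_pos hρ₀
  have hl : Real.log ρ₀ ≤ Real.log ρ := Real.log_le_log (by linarith) hρ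
  set κ := 1 + 1 / Real.log ρ₀ with hκ
  have hκ1 : 1 ≤ κ := by rw [hκ]; have := one_div_pos.2 hl₀; linarith
  have hle : 1 + Real.log ρ ≤ κ * Real.log ρ := by
    have : 1 ≤ 1 / Real.log ρ₀ * Real.log ρ := by
      rw [one_div_mul_eq_div, le_div_iff₀ hl₀]; linarith
    rw [hκ]; linarith
  have hl' : 0 < Real.log ρ := hl₀.trans_le hl
  have h1 : 1 / T * (B * (n * (1 + Real.log ρ))) ≤ κ * (B * n / T * Real.log ρ) := by
    calc 1 / T * (B * (n * (1 + Real.log ρ))) ≤ 1 / T * (B * (n * (κ * Real.log ρ))) := by gcongr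
      _ = _ := by ring
  have h2 : 1 / T * √(Δ * T * B * (n * (1 + Real.log ρ))) ≤
      κ * √(Δ * B * n / T * Real.log ρ) := by
    have e1 : 1 / T * √(Δ * T * B * (n * (1 + Real.log ρ))) =
        √(Δ * B * n / T * (1 + Real.log ρ)) := by
      rw [← Real.sqrt_sq (by positivity : 0 ≤ 1 / T), ← Real.sqrt_mul (by positivity)]
      congr 1; field_simp
    have e2 : κ * √(Δ * B * n / T * Real.log ρ) = √(κ ^ 2 * (Δ * B * n / T * Real.log ρ)) := by
      rw [Real.sqrt_mul (sq_nonneg κ), Real.sqrt_sq (by linarith)]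
    rw [e1, e2]
    apply Real.sqrt_le_sqrt
    calc Δ * B * n / T * (1 + Real.log ρ) ≤ Δ * B * n / T * (κ * Real.log ρ) := by gcongr
      _ = κ * 1 * (Δ * B * n / T * Real.log ρ) := by ring
      _ ≤ κ * κ * (Δ * B * n / T * Real.log ρ) := by gcongr
      _ = _ := by ring
  linarith

/-- The excess loss of the first component over `c'` on the observation in the second one. -/
noncomputable def excessLoss {n : ℕ} (c' : E n) (p : E n × Observation n) : ℝ :=
  suboptLoss p.2 p.1 - suboptLoss p.2 c'

lemma measurable_excessLoss {n : ℕ} (c' : E n) : Measurable (excessLoss c') := by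
  have h : Measurable fun p : E n × Observation n => (c', p.2) :=
    measurable_const.prodMk measurable_snd
  have h1 := measurable_suboptLoss.comp h
  unfold excessLoss
  exact Measurable.sub measurable_suboptLoss h1

/-- On every sample path, the cumulative excess loss of MetaGrad is bounded. -/
lemma sum_suboptLoss_sub_le {n T : ℕ} {Θ : Set (E n)} {D K B Δ : ℝ}
    {w₁ : Fin (gridMax T + 1) → E n} {o : ℕ → Observation n} {xhat chat : ℕ → E n}
    (hn : 0 < n) (hT : 0 < T) (hD : 0 < D) (hK : 0 < K) (hB : 0 < B) (hΔ : 0 ≤ Δ)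
    (hρ : 1 ≤ D * K * T / (B * n)) (hΘ : IsCompact Θ) (hconv : Convex ℝ Θ)
    (hdiam : ∀ c ∈ Θ, ∀ c' ∈ Θ, ‖c - c'‖ ≤ D) (hw : ∀ i, w₁ i ∈ Θ) {u : E n} (hu : u ∈ Θ)
    (hchat : ∀ t < T, chat t = metaGrad Θ D B w₁ (fun s => xhat s - (o s).x) t)
    (hargmax : ∀ t < T, xhat t ∈ linArgmax ((o t).X) (chat t))
    (hoK : ∀ t < T, ∀ x ∈ (o t).X, ∀ x' ∈ (o t).X, ‖x - x'‖ ≤ K)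
    (hoB : ∀ t < T, ∀ c ∈ Θ, ∀ c' ∈ Θ, ∀ x ∈ (o t).X, ∀ x' ∈ (o t).X, ⟪c - c', x - x'⟫ ≤ B)
    (hoΔ : ∀ t < T, suboptLoss (o t) u ≤ Δ) :
    ∑ t ∈ Finset.range T, (suboptLoss (o t) (chat t) - suboptLoss (o t) u) ≤
      90 * (B * (n * (1 + Real.log (D * K * T / (B * n)))) +
        √(Δ * T * B * (n * (1 + Real.log (D * K * T / (B * n)))))) := by
  -- The subgradient inequality: the maximizer at `chat t` is merely feasible for `u`.
  have hle : ∀ t < T, suboptLoss (o t) (chat t) - suboptLoss (o t) u ≤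
      ⟪metaGrad Θ D B w₁ (fun s => xhat s - (o s).x) t - u, xhat t - (o t).x⟫ := by
    intro t ht
    have h := inner_sub_le_suboptLoss (o t) u (hargmax t ht).1
    rw [suboptLoss_eq_of_mem_linArgmax _ (hargmax t ht), inner_sub_left, ← hchat t ht]
    linarith
  refine (Finset.sum_le_sum fun t ht => hle t (Finset.mem_range.1 ht)).trans ?_
  refine metaGrad_sum_le hn hT hD hK hB hΔ hρ hΘ hconv hdiam hw hu
    (fun t ht c hc c' hc' => ?_) (fun t ht => hoK t ht _ (hargmax t ht).1 _ (o t).mem)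
    fun t ht => ?_
  · rw [abs_le]
    refine ⟨?_, hoB t ht c hc c' hc' _ (hargmax t ht).1 _ (o t).mem⟩
    have := hoB t ht c' hc' c hc _ (hargmax t ht).1 _ (o t).mem
    rw [← neg_sub c c', inner_neg_left] at this
    linarith
  · have h0 := suboptLoss_nonneg (o t) (chat t)
    have h1 := hoΔ t ht
    exact le_trans (by linarith) (hle t ht)

end InverseOpt

/-! ### Online-to-batch conversion -/

theorem corollary1 (ρ₀ : ℝ) (hρ₀ : 1 < ρ₀) :
    ∃ C : ℝ, 0 < C ∧
      ∀ (n T : ℕ) (D K B Δ : ℝ), 0 < D → 0 < K → 0 < B → 0 ≤ Δ →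
      ρ₀ ≤ D * K * T / (B * n) →
      -- the set of objective vectors and the true objective
      ∀ (Θ : Set (InverseOpt.E n)), IsClosed Θ → Convex ℝ Θ →
      (∀ c ∈ Θ, ∀ c' ∈ Θ, ‖c - c'‖ ≤ D) →
      ∀ cstar ∈ Θ,
      -- the distribution of the observations
      ∀ (μ : Measure (InverseOpt.Observation n)) [IsProbabilityMeasure μ],
      (∀ᵐ o ∂μ, ∀ x ∈ o.X, ∀ x' ∈ o.X, ‖x - x'‖ ≤ K) →
      (∀ᵐ o ∂μ, ∀ c ∈ Θ, ∀ c' ∈ Θ, ∀ x ∈ o.X, ∀ x' ∈ o.X, ⟪c - c', x - x'⟫ ≤ B) →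
      (∀ᵐ o ∂μ, InverseOpt.suboptLoss o cstar ≤ Δ) →
      -- the i.i.d. observations of the rounds `0, …, T - 1`
      ∀ {Ω : Type*} [MeasurableSpace Ω] (P : Measure Ω) [IsProbabilityMeasure P]
        (obs : ℕ → Ω → InverseOpt.Observation n),
      (∀ t < T, Measurable (obs t)) →
      (∀ t < T, P.map (obs t) = μ) →
      iIndepFun (fun t : Fin T => obs t) P →
      -- the experts' starting points, the learner's predictions and the induced optimal actions
      ∀ (w₁ : Fin (InverseOpt.gridMax T + 1) → InverseOpt.E n), (∀ i, w₁ i ∈ Θ) →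
      ∀ (xhat chat : ℕ → Ω → InverseOpt.E n),
      (∀ t ω, chat t ω =
        InverseOpt.metaGrad Θ D B w₁ (fun s => xhat s ω - (obs s ω).x) t) →
      (∀ t < T, ∀ᵐ ω ∂P, xhat t ω ∈ InverseOpt.linArgmax ((obs t ω).X) (chat t ω)) →
      (∀ t < T, Measurable[⨆ s ∈ Set.Iic t, MeasurableSpace.comap (obs s) inferInstance]
        (xhat t)) →
      -- the expected excess loss of the average prediction on a fresh observation
      Integrable (fun p : Ω × InverseOpt.Observation n =>
        InverseOpt.suboptLoss p.2 ((1 / (T : ℝ)) • ∑ t ∈ Finset.range T, chat t p.1) -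
          InverseOpt.suboptLoss p.2 cstar) (P.prod μ) ∧
      ∫ p : Ω × InverseOpt.Observation n,
        (InverseOpt.suboptLoss p.2 ((1 / (T : ℝ)) • ∑ t ∈ Finset.range T, chat t p.1) -
          InverseOpt.suboptLoss p.2 cstar) ∂(P.prod μ) ≤
        C * (B * n / T * Real.log (D * K * T / (B * n)) +
          √(Δ * B * n / T * Real.log (D * K * T / (B * n)))) := by
  have hlρ₀ : 0 < Real.log ρ₀ := Real.log_pos hρ₀
  refine ⟨90 * (1 + 1 / Real.log ρ₀), by positivity, ?_⟩
  intro n T D K B Δ hD hK hB hΔ hρ Θ hclosed hconv hdiam cstar hcstar μ _ hμK hμB hμΔ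
    Ω _ P _ obs hobs hmap hind w₁ hw xhat chat hchat hargmax hxhat
  have hn : 0 < n := by
    rcases Nat.eq_zero_or_pos n with h | h
    · subst h
      -- Division by zero gives 0, so the bound `ρ₀ ≤ 0` excludes n = 0.
      simp only [Nat.cast_zero, mul_zero, div_zero] at hρ
      linarith
    · exact h
  have hT : 0 < T := by
    rcases Nat.eq_zero_or_pos T with h | h
    · subst h
      simp only [Nat.cast_zero, mul_zero, zero_div] at hρ
      linarith
    · exact h
  have hn' : (0 : ℝ) < n := by exact_mod_cast hn
  have hT' : (0 : ℝ) < T := by exact_mod_cast hT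
  have hΘ : IsCompact Θ := Metric.isCompact_of_isClosed_isBounded hclosed
    (Metric.isBounded_iff.2 ⟨D, fun c hc c' hc' => by rw [dist_eq_norm]; exact hdiam c hc c' hc'⟩)
  have hmem : ∀ t ω, chat t ω ∈ Θ := fun t ω => by
    rw [hchat]; exact InverseOpt.metaGrad_mem _ hΘ hconv hB hw t
  have hhist : ∀ t < T, Measurable[⨆ s ∈ Set.Iio t, MeasurableSpace.comap (obs s) inferInstance]
      (chat t) := by
    intro t ht
    rw [funext (hchat t)]
    refine InverseOpt.measurable_metaGrad (g := fun s ω => xhat s ω - (obs s ω).x)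
      hn hD hB hΘ hconv hw t fun s hs => ?_
    -- The action of round `s` may use observation `s` itself; for `s < t` this is still history
    -- before `t`.
    have h1 := (hxhat s (hs.trans ht)).mono
      (biSup_mono (f := fun s => MeasurableSpace.comap (obs s) inferInstance)
        fun r hr => lt_of_le_of_lt hr hs : _ ≤ ⨆ s ∈ Set.Iio t, _) le_rfl
    have h2 := (InverseOpt.Observation.measurable_x.comp (comap_measurable (obs s))).mono
      (le_iSup₂_of_le (f := fun s (_ : s ∈ Set.Iio t) =>
        MeasurableSpace.comap (obs s) inferInstance) s hs le_rfl) le_rfl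
    exact h1.sub h2
  have hchatm : ∀ t < T, Measurable (chat t) := fun t ht =>
    (hhist t ht).mono (iSup₂_le fun s hs => (hobs s (lt_trans hs ht)).comap_le) le_rfl
  have hφ := InverseOpt.measurable_excessLoss cstar
  have hbdd : ∀ᵐ o ∂μ, ∀ c ∈ Θ, ‖InverseOpt.excessLoss cstar (c, o)‖ ≤ B + Δ := by
    filter_upwards [hμB, hμΔ] with o h1 h2 c hc
    exact InverseOpt.abs_suboptLoss_sub_le hB.le (h1 c hc cstar hcstar) h2
  have hint : ∀ c : Ω → InverseOpt.E n, Measurable c → (∀ ω, c ω ∈ Θ) →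
      Integrable (fun p : Ω × InverseOpt.Observation n =>
        InverseOpt.excessLoss cstar (c p.1, p.2)) (P.prod μ) := by
    intro c hc hcΘ
    refine Integrable.of_bound (hφ.comp
      ((hc.comp measurable_fst).prodMk measurable_snd)).aestronglyMeasurable (B + Δ) ?_
    filter_upwards [Measure.quasiMeasurePreserving_snd.ae hbdd] with p hp
    exact hp _ (hcΘ p.1)
  have hbddobs : ∀ t < T, ∀ᵐ ω ∂P, ∀ c ∈ Θ,
      ‖InverseOpt.excessLoss cstar (c, obs t ω)‖ ≤ B + Δ := fun t ht =>
    ae_of_ae_map (hobs t ht).aemeasurable (by rw [hmap t ht]; exact hbdd)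
  have hintobs : ∀ t < T,
      Integrable (fun ω => InverseOpt.excessLoss cstar (chat t ω, obs t ω)) P := by
    intro t ht
    refine Integrable.of_bound
      (hφ.comp ((hchatm t ht).prodMk (hobs t ht))).aestronglyMeasurable (B + Δ) ?_
    filter_upwards [hbddobs t ht] with ω hω
    exact hω _ (hmem t ω)
  have havgm : Measurable fun ω => (1 / (T : ℝ)) • ∑ t ∈ Finset.range T, chat t ω :=
    (Finset.measurable_fun_sum _ fun t ht => hchatm t (Finset.mem_range.1 ht)).const_smul
      (1 / (T : ℝ))
  have havgmem : ∀ ω, (1 / (T : ℝ)) • ∑ t ∈ Finset.range T, chat t ω ∈ Θ := by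
    intro ω
    rw [Finset.smul_sum]
    refine hconv.sum_mem (fun _ _ => by positivity) ?_ fun t _ => hmem t ω
    rw [Finset.sum_const, Finset.card_range, nsmul_eq_mul]
    field_simp
  have hregret : ∀ᵐ ω ∂P, ∑ t ∈ Finset.range T, InverseOpt.excessLoss cstar (chat t ω, obs t ω) ≤
      90 * (B * (n * (1 + Real.log (D * K * T / (B * n)))) +
        √(Δ * T * B * (n * (1 + Real.log (D * K * T / (B * n)))))) := by
    have hall : ∀ᵐ ω ∂P, ∀ t < T,
        xhat t ω ∈ InverseOpt.linArgmax ((obs t ω).X) (chat t ω) ∧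
        (∀ x ∈ (obs t ω).X, ∀ x' ∈ (obs t ω).X, ‖x - x'‖ ≤ K) ∧
        (∀ c ∈ Θ, ∀ c' ∈ Θ, ∀ x ∈ (obs t ω).X, ∀ x' ∈ (obs t ω).X, ⟪c - c', x - x'⟫ ≤ B) ∧
        InverseOpt.suboptLoss (obs t ω) cstar ≤ Δ := by
      rw [ae_all_iff]
      intro t
      by_cases ht : t < T
      · have h1 := ae_of_ae_map (hobs t ht).aemeasurable (by rw [hmap t ht]; exact hμK)
        have h2 := ae_of_ae_map (hobs t ht).aemeasurable (by rw [hmap t ht]; exact hμB)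
        have h3 := ae_of_ae_map (hobs t ht).aemeasurable (by rw [hmap t ht]; exact hμΔ)
        filter_upwards [hargmax t ht, h1, h2, h3] with ω a b c d _
        exact ⟨a, b, c, d⟩
      · exact Filter.Eventually.of_forall fun ω h => absurd h ht
    filter_upwards [hall] with ω hω
    exact InverseOpt.sum_suboptLoss_sub_le hn hT hD hK hB hΔ (hρ₀.le.trans hρ) hΘ hconv hdiam hw
      hcstar (fun t _ => hchat t ω) (fun t ht => (hω t ht).1) (fun t ht => (hω t ht).2.1)
      (fun t ht => (hω t ht).2.2.1) fun t ht => (hω t ht).2.2.2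
  have hintavg := hint _ havgm havgmem
  refine ⟨hintavg, ?_⟩
  have hsumle : ∫ ω, ∑ t ∈ Finset.range T, InverseOpt.excessLoss cstar (chat t ω, obs t ω) ∂P ≤
      90 * (B * (n * (1 + Real.log (D * K * T / (B * n)))) +
        √(Δ * T * B * (n * (1 + Real.log (D * K * T / (B * n)))))) := by
    refine (integral_mono_ae (integrable_finsetSum _ fun t ht => hintobs t (Finset.mem_range.1 ht))
      (integrable_const _) hregret).trans_eq ?_
    simp
  calc ∫ p : Ω × InverseOpt.Observation n,
        InverseOpt.excessLoss cstar
          ((1 / (T : ℝ)) • ∑ t ∈ Finset.range T, chat t p.1, p.2) ∂(P.prod μ)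
      ≤ ∫ p : Ω × InverseOpt.Observation n,
          1 / (T : ℝ) * ∑ t ∈ Finset.range T,
            InverseOpt.excessLoss cstar (chat t p.1, p.2) ∂(P.prod μ) := by
        refine integral_mono hintavg ((integrable_finsetSum _ fun t ht =>
          hint _ (hchatm t (Finset.mem_range.1 ht)) (hmem t)).const_mul _) fun p => ?_
        have h := InverseOpt.suboptLoss_average_le p.2 hT fun t => chat t p.1
        simp only [InverseOpt.excessLoss]
        rw [Finset.sum_sub_distrib, mul_sub, Finset.sum_const, Finset.card_range, nsmul_eq_mul,
          ← mul_assoc, one_div_mul_cancel hT'.ne', one_mul]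
        linarith
    -- Term by term, the fresh observation is exchanged for that of round t, which is independent of
    -- the prediction.
    _ = 1 / (T : ℝ) *
          ∫ ω, ∑ t ∈ Finset.range T, InverseOpt.excessLoss cstar (chat t ω, obs t ω) ∂P := by
        rw [integral_const_mul, integral_finsetSum _ fun t ht =>
          hint _ (hchatm t (Finset.mem_range.1 ht)) (hmem t),
          integral_finsetSum _ fun t ht => hintobs t (Finset.mem_range.1 ht)]
        congr 1
        refine Finset.sum_congr rfl fun t ht => ?_
        have ht' := Finset.mem_range.1 ht
        exact InverseOpt.integral_prod_eq_of_indepFun (hchatm t ht') (hobs t ht') (hmap t ht')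
          (InverseOpt.indepFun_of_measurable_history hobs hind ht' (hhist t ht')) hφ
    _ ≤ 1 / (T : ℝ) * (90 * (B * (n * (1 + Real.log (D * K * T / (B * n)))) +
        √(Δ * T * B * (n * (1 + Real.log (D * K * T / (B * n))))))) := by gcongr
    _ ≤ _ := InverseOpt.rate_le hρ₀ hn' hT' hB.le hΔ hρ
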